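/- **Proposition.** Let $F$ be a number field and let $j\ge 1$ be an integer. Let $X=\operatorname{Spec}(F\otimes_{\mathbb Q}\mathbb R)$, so that $X(\mathbb C)$ is the set of embeddings $\sigma:F\hookrightarrow\mathbb C$, with the involution $\iota:\sigma\mapsto\bar\sigma$. Let $\operatorname{Var}(X/\mathbb R)$ be the $\mathbb Q$-linear abelian category of (admissible) variations of mixed $\mathbb Q$-Hodge structure over $\mathbb R$ on $X$: since $X$ is proper of dimension $0$, an object is a family $\mathbb V=(\mathbb V_\sigma)_\sigma$ of mixed $\mathbb Q$-Hodge structures (finite-dimensional rational space, weight filtration $W_*$, Hodge filtration $F^*$) together with a morphism $F_\infty:\mathbb V\to\iota^*\mathbb V$ satisfying $F_\infty^{-1}=\iota^*F_\infty$, where $(\iota^*\mathbb V)_\sigma=(\mathbb V_{\bar\sigma},W_*,\overline{F}{}^*)$; morphisms are families of morphisms of mixed Hodge structures commuting with $F_\infty$. The object $\mathbb Q(j)$ has at every $\sigma$ the rational space $(2\pi i)^j\mathbb Q\subset\mathbb C$, is of Hodge type $(-j,-j)$, and $F_\infty$ is complex conjugation on $(2\pi i)^j\mathbb Q$. Then there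 is a canonical isomorphism of $\mathbb Q$-vector spaces $$\operatorname{Ext}^1_{\operatorname{Var}(F\otimes_{\mathbb Q}\mathbb R/\mathbb R)}(\mathbb Q(0),\mathbb Q(j))\;\xrightarrow{\ \sim\ }\;\Bigl(\bigoplus_{\sigma:F\hookrightarrow\mathbb C}\mathbb C/(2\pi i)^j\mathbb Q\Bigr)^{+},$$ where $+$ denotes the invariants under the joint action of complex conjugation on the set of embeddings and on $\mathbb C/(2\pi i)^j\mathbb Q$. It is the unique $\mathbb Q$-linear isomorphism with the following property: for every extension $0\to\mathbb Q(j)\to\mathbb E\to\mathbb Q(0)\to0$ and every $\sigma$, the component at $\sigma$ of the image of its class is the class of $e_F-e_{\mathbb Q}\in\mathbb Q(j)_{\mathbb C}=\mathbb C$ modulo $(2\pi i)^j\mathbb Q$, for all lifts $e_{\mathbb Q}\in\mathbb E_{\sigma,\mathbb Q}$ and $e_F\in F^0\mathbb E_{\sigma,\mathbb C}$ of $1\in\mathbb Q(0)$. -/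

import Mathlib

universe u

open TensorProduct CategoryTheory CategoryTheory.Limits

namespace Hodge

section Filtrations

variable {k V V' : Type*} [Field k] [AddCommGroup V] [Module k V] [AddCommGroup V'] [Module k V']

/-- `F` and `G` induce `n`-opposed filtrations on `Gr^W_n = W_n / W_{n-1}` for every `n`: whenever
`p + q = n + 1`, the space `Gr^W_n` is the direct sum of `F^p Gr^W_n` (the image of `F^p ∩ W_n`) and
of `G^q Gr^W_n` (the image of `G^q ∩ W_n`).  Both conditions are written with the preimages in `W_n`
of subspaces of `Gr^W_n`. -/
def Opposed (W F G : ℤ → Submodule k V) : Prop :=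
  ∀ n p q : ℤ, p + q = n + 1 →
    (F p ⊓ W n ⊔ W (n - 1)) ⊔ (G q ⊓ W n ⊔ W (n - 1)) = W n ∧
    (F p ⊓ W n ⊔ W (n - 1)) ⊓ (G q ⊓ W n ⊔ W (n - 1)) = W (n - 1)

/-- A finite increasing filtration `W` and finite decreasing filtrations `F`, `G` which are
opposed. -/
structure IsTriple (W F G : ℤ → Submodule k V) : Prop where
  W_mono : Monotone W
  W_bot : ∃ n, W n = ⊥
  W_top : ∃ n, W n = ⊤
  F_anti : Antitone F
  F_bot : ∃ p, F p = ⊥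
  F_top : ∃ p, F p = ⊤
  G_anti : Antitone G
  G_bot : ∃ p, G p = ⊥
  G_top : ∃ p, G p = ⊤
  opposed : Opposed W F G

/-- A linear map that respects three filtrations. -/
structure Respects (W F G : ℤ → Submodule k V) (W' F' G' : ℤ → Submodule k V')
    (f : V →ₗ[k] V') : Prop where
  map_W : ∀ n x, x ∈ W n → f x ∈ W' n
  map_F : ∀ n x, x ∈ F n → f x ∈ F' n
  map_G : ∀ n x, x ∈ G n → f x ∈ G' n

variable {W F G : ℤ → Submodule k V} {W' F' G' : ℤ → Submodule k V'} {f : V →ₗ[k] V'}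

theorem IsTriple.swap (h : IsTriple W F G) : IsTriple W G F where
  W_mono := h.W_mono
  W_bot := h.W_bot
  W_top := h.W_top
  F_anti := h.G_anti
  F_bot := h.G_bot
  F_top := h.G_top
  G_anti := h.F_anti
  G_bot := h.F_bot
  G_top := h.F_top
  opposed n p q e := by
    have := h.opposed n q p (by omega)
    exact ⟨(sup_comm _ _).trans this.1, (inf_comm _ _).trans this.2⟩

theorem Respects.swap (h : Respects W F G W' F' G' f) : Respects W G F W' G' F' f :=
  ⟨h.map_W, h.map_G, h.map_F⟩

theorem IsTriple.decomp (h : IsTriple W F G) {n p q : ℤ} (e : p + q = n + 1) {x : V}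
    (hx : x ∈ W n) : ∃ a ∈ F p ⊓ W n, ∃ b ∈ G q ⊓ W n, ∃ c ∈ W (n - 1), x = a + b + c := by
  rw [← (h.opposed n p q e).1] at hx
  obtain ⟨y, hy, z, hz, rfl⟩ := Submodule.mem_sup.1 hx
  obtain ⟨a, ha, c, hc, rfl⟩ := Submodule.mem_sup.1 hy
  obtain ⟨b, hb, d, hd, rfl⟩ := Submodule.mem_sup.1 hz
  exact ⟨a, ha, b, hb, c + d, add_mem hc hd, by abel⟩

theorem IsTriple.disj (h : IsTriple W F G) {n p q : ℤ} (e : p + q = n + 1) {a b : V}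
    (ha : a ∈ F p ⊓ W n) (hb : b ∈ G q ⊓ W n) (hab : a - b ∈ W (n - 1)) :
    a ∈ W (n - 1) ∧ b ∈ W (n - 1) := by
  have h1 : a ∈ W (n - 1) := by
    rw [← (h.opposed n p q e).2]
    refine ⟨Submodule.mem_sup_left ha, ?_⟩
    have : a = b + (a - b) := by abel
    rw [this]
    exact add_mem (Submodule.mem_sup_left hb) (Submodule.mem_sup_right hab)
  exact ⟨h1, by simpa using sub_mem h1 hab⟩

/-- `Σ_{i ≥ 0} G^{q-i} ∩ W_{m-i}`. -/
def tail (W G : ℤ → Submodule k V) (q m : ℤ) : Submodule k V :=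
  ⨆ i : ℕ, G (q - i) ⊓ W (m - i)

theorem tail_eq (q m : ℤ) : tail W G q m = G q ⊓ W m ⊔ tail W G (q - 1) (m - 1) := by
  unfold tail
  rw [← sup_iSup_nat_succ]
  congr 1
  · simp
  · refine iSup_congr fun i => ?_
    push_cast
    rw [show q - 1 - (i : ℤ) = q - (i + 1) by ring, show m - 1 - (i : ℤ) = m - (i + 1) by ring]

theorem tail_le (h : IsTriple W F G) (q m : ℤ) : tail W G q m ≤ W m :=
  iSup_le fun i => inf_le_right.trans (h.W_mono (by omega))

theorem le_tail (q m : ℤ) (i : ℕ) : G (q - i) ⊓ W (m - i) ≤ tail W G q m :=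
  le_iSup (fun i : ℕ => G (q - i) ⊓ W (m - i)) i

/-- The canonical bigrading of a mixed Hodge structure. -/
def bigr (W F G : ℤ → Submodule k V) (p q : ℤ) : Submodule k V :=
  F p ⊓ W (p + q) ⊓ (G q ⊓ W (p + q) ⊔ tail W G (q - 1) (p + q - 2))

theorem F_tail_eq_zero (h : IsTriple W F G) (k' : ℕ) : ∀ (p q m : ℤ) (_ : p + q = m + 1)
    (_ : W (m - k') = ⊥) {u : V} (_ : u ∈ F p) (_ : u ∈ tail W G q m), u = 0 := by
  induction k' with
  | zero =>
    intro p q m e hb u _ hu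
    have := tail_le h q m hu
    simpa [show W m = ⊥ by simpa using hb] using this
  | succ k' ih =>
    intro p q m e hb u hF hu
    have hWm := tail_le h q m hu
    rw [tail_eq] at hu
    obtain ⟨g, hg, r, hr, rfl⟩ := Submodule.mem_sup.1 hu
    have hr' := tail_le h _ _ hr
    obtain ⟨h1, h2⟩ := h.disj e ⟨hF, hWm⟩ hg (by simpa using hr')
    have hb' : W (m - 1 - (k' : ℤ)) = ⊥ := by rw [← hb]; push_cast; congr 1; ring
    refine ih p (q - 1) (m - 1) (by omega) hb' hF (add_mem ?_ hr)
    have := le_tail (W := W) (G := G) (q - 1) (m - 1) 0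
    exact this ⟨h.G_anti (by simp) hg.1, by simpa using h2⟩

theorem exists_W_bot (h : IsTriple W F G) (m : ℤ) : ∃ k' : ℕ, W (m - k') = ⊥ := by
  obtain ⟨n, hn⟩ := h.W_bot
  refine ⟨(m - n).toNat, ?_⟩
  rw [eq_bot_iff, ← hn]
  exact h.W_mono (by omega)

theorem bigr_eq_zero (h : IsTriple W F G) {p q : ℤ} {u : V} (hu : u ∈ bigr W F G p q)
    (hW : u ∈ W (p + q - 1)) : u = 0 := by
  obtain ⟨⟨hF, -⟩, hu⟩ := hu
  obtain ⟨g, hg, r, hr, rfl⟩ := Submodule.mem_sup.1 hu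
  have hr' := tail_le h _ _ hr
  have hgW : g ∈ W (p + q - 1) := by
    have := sub_mem hW (h.W_mono (by omega) hr' : r ∈ W (p + q - 1))
    simpa using this
  obtain ⟨h1, h2⟩ := h.disj (n := p + q - 1) (p := p) (q := q) (by omega) ⟨hF, hW⟩ ⟨hg.1, hgW⟩
    (by simpa using h.W_mono (by omega) hr')
  obtain ⟨k', hk⟩ := exists_W_bot h (p + q - 2)
  refine F_tail_eq_zero h k' p (q - 1) (p + q - 2) (by omega) hk hF (add_mem ?_ hr)
  have := le_tail (W := W) (G := G) (q - 1) (p + q - 2) 0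
  refine this ⟨h.G_anti (by simp) hg.1, ?_⟩
  simpa [show p + q - 1 - 1 = p + q - 2 by ring] using h2

theorem exists_bigr (h : IsTriple W F G) {p q : ℤ} {x b : V} (hx : x ∈ F p ⊓ W (p + q))
    (hb : b ∈ G q ⊓ W (p + q)) (hxb : x - b ∈ W (p + q - 1)) :
    ∃ i ∈ bigr W F G p q, x - i ∈ W (p + q - 1) := by
  have key : ∀ k' : ℕ, ∃ u ∈ F p ⊓ W (p + q),
      ∃ v ∈ G q ⊓ W (p + q) ⊔ tail W G (q - 1) (p + q - 2),
      u - v ∈ W (p + q - 1 - k') ∧ x - u ∈ W (p + q - 1) := by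
    intro k'
    induction k' with
    | zero => exact ⟨x, hx, b, Submodule.mem_sup_left hb, by simpa using hxb, by simp⟩
    | succ k' ih =>
      obtain ⟨u, hu, v, hv, huv, hxu⟩ := ih
      obtain ⟨a, ha, g, hg, c, hc, e⟩ := h.decomp (p := p) (q := q - k') (by ring) huv
      have haW := h.W_mono (show p + q - 1 - (k' : ℤ) ≤ p + q - 1 by omega) ha.2
      refine ⟨u - a, sub_mem hu ⟨ha.1, h.W_mono (by omega) haW⟩, v + g, add_mem hv ?_, ?_, ?_⟩
      · rcases Nat.eq_zero_or_pos k' with rfl | hk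
        · refine Submodule.mem_sup_left ⟨by simpa using hg.1, h.W_mono (by omega) hg.2⟩
        · refine Submodule.mem_sup_right (le_tail (W := W) (G := G) (q - 1) (p + q - 2) (k' - 1) ?_)
          rw [Nat.cast_sub hk]
          push_cast
          rw [show q - 1 - ((k' : ℤ) - 1) = q - k' by ring,
            show p + q - 2 - ((k' : ℤ) - 1) = p + q - 1 - k' by ring]
          exact hg
      · have : u - a - (v + g) = c := by
          have : u - a - (v + g) = (u - v) - a - g := by abel
          rw [this, e]; abel
        rw [this]
        push_cast
        rwa [show p + q - 1 - ((k' : ℤ) + 1) = p + q - 1 - k' - 1 by ring]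
      · have : x - (u - a) = (x - u) + a := by abel
        rw [this]
        exact add_mem hxu haW
  obtain ⟨k', hk⟩ := exists_W_bot h (p + q - 1)
  obtain ⟨u, hu, v, hv, huv, hxu⟩ := key k'
  rw [hk, Submodule.mem_bot, sub_eq_zero] at huv
  exact ⟨u, ⟨hu, huv ▸ hv⟩, hxu⟩

theorem exists_bigr_decomp (h : IsTriple W F G) {n p : ℤ} {x : V} (hx : x ∈ F p ⊓ W n) :
    ∃ i ∈ bigr W F G p (n - p), ∃ b ∈ F (p + 1) ⊓ W n, ∃ w ∈ F p ⊓ W (n - 1), x = i + b + w := by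
  obtain ⟨b, hb, g, hg, c, hc, e⟩ := h.decomp (p := p + 1) (q := n - p) (by ring) hx.2
  have hbF : b ∈ F p := h.F_anti (by omega) hb.1
  have e1 : p + (n - p) = n := by ring
  obtain ⟨i, hi, hxi⟩ := exists_bigr h (p := p) (q := n - p) (x := x - b) (b := g)
    (by rw [e1]; exact sub_mem hx ⟨hbF, hb.2⟩) (by rwa [e1])
    (by rw [e1, e]; convert hc using 1; abel)
  refine ⟨i, hi, b, hb, x - b - i, ⟨sub_mem (sub_mem hx.1 hbF) hi.1.1, by rwa [e1] at hxi⟩, by abel⟩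

theorem map_bigr (hf : Respects W F G W' F' G' f) {p q : ℤ} {x : V} (hx : x ∈ bigr W F G p q) :
    f x ∈ bigr W' F' G' p q := by
  refine ⟨⟨hf.map_F _ _ hx.1.1, hf.map_W _ _ hx.1.2⟩, ?_⟩
  have hle : G q ⊓ W (p + q) ⊔ tail W G (q - 1) (p + q - 2) ≤
      (G' q ⊓ W' (p + q) ⊔ tail W' G' (q - 1) (p + q - 2)).comap f := by
    refine sup_le ?_ (iSup_le fun i => ?_)
    · exact fun y hy => Submodule.mem_sup_left ⟨hf.map_G _ _ hy.1, hf.map_W _ _ hy.2⟩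
    · exact fun y hy => Submodule.mem_sup_right
        (le_tail _ _ i ⟨hf.map_G _ _ hy.1, hf.map_W _ _ hy.2⟩)
  exact hle hx.2

/-- A `(p, n - p)` component whose image lies in `F^{p+1} + W_{n-1}` is killed. -/
theorem map_bigr_eq_zero (h' : IsTriple W' F' G') (hf : Respects W F G W' F' G' f) {n p : ℤ}
    {i : V} (hi : i ∈ bigr W F G p (n - p)) {y c : V'} (hy : y ∈ F' (p + 1) ⊓ W' n)
    (hc : c ∈ W' (n - 1)) (e : f i = y + c) : f i = 0 := by
  have hb := map_bigr hf hi
  have e1 : p + (n - p) = n := by ring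
  refine bigr_eq_zero h' hb ?_
  rw [e1]
  obtain ⟨g, hg, r, hr, egr⟩ := Submodule.mem_sup.1 hb.2
  rw [e1] at hg hr
  have hr' := h'.W_mono (show n - 2 ≤ n - 1 by omega) (tail_le h' _ _ hr)
  have := (h'.disj (p := p + 1) (q := n - p) (by ring) hy hg ?_).1
  · rw [e]; exact add_mem this hc
  · have : y - g = r - c := by
      rw [sub_eq_sub_iff_add_eq_add, ← e, ← egr]; abel
    rw [this]; exact sub_mem hr' hc

theorem strict_gr (h : IsTriple W F G) (h' : IsTriple W' F' G') (hf : Respects W F G W' F' G' f)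
    {n p : ℤ} {a : V} (ha : a ∈ F p ⊓ W n) (hfa : f a ∈ W' (n - 1)) :
    ∃ a' ∈ F p ⊓ W (n - 1), f a' = f a := by
  obtain ⟨p₁, hp₁⟩ := h.F_bot
  have key : ∀ (m : ℕ) (p : ℤ), F (p + m) = ⊥ → ∀ a ∈ F p ⊓ W n, f a ∈ W' (n - 1) →
      ∃ a' ∈ F p ⊓ W (n - 1), f a' = f a := by
    intro m
    induction m with
    | zero =>
      intro p hp a ha _
      have : a = 0 := by simpa [show F p = ⊥ by simpa using hp] using ha.1
      exact ⟨0, zero_mem _, by simp [this]⟩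
    | succ m ih =>
      intro p hp a ha hfa
      obtain ⟨i, hi, b, hb, w, hw, rfl⟩ := exists_bigr_decomp h ha
      have hfw := hf.map_W _ _ hw.2
      have hi0 : f i = 0 := by
        refine map_bigr_eq_zero h' hf hi (y := -f b) (c := f (i + b + w) - f w)
          (neg_mem ⟨hf.map_F _ _ hb.1, hf.map_W _ _ hb.2⟩) (sub_mem hfa hfw) ?_
        simp only [map_add]; abel
      obtain ⟨b', hb', e⟩ := ih (p + 1) (by rw [← hp]; push_cast; congr 1; ring) b hb (by
        have := sub_mem hfa hfw
        simpa [hi0] using this)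
      exact ⟨b' + w, add_mem ⟨h.F_anti (by omega) hb'.1, hb'.2⟩ hw, by simp [e, hi0]⟩
  refine key (p₁ - p).toNat p ?_ a ha hfa
  rw [eq_bot_iff, ← hp₁]
  exact h.F_anti (by omega)

theorem strict_step (h : IsTriple W F G) (h' : IsTriple W' F' G') (hf : Respects W F G W' F' G' f)
    {n p : ℤ} (m : ℕ) : ∀ {r : ℤ}, r + m = p → ∀ x ∈ F r ⊓ W n, f x ∈ F' p ⊓ W' n ⊔ W' (n - 1) →
    ∃ y ∈ F p ⊓ W n, ∃ w ∈ W (n - 1), f x = f y + f w := by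
  induction m with
  | zero =>
    intro r hr x hx _
    obtain rfl : r = p := by simpa using hr
    exact ⟨x, hx, 0, zero_mem _, by simp⟩
  | succ m ih =>
    intro r hr x hx hfx
    push_cast at hr
    obtain ⟨i, hi, b, hb, w, hw, rfl⟩ := exists_bigr_decomp h hx
    have hfw := hf.map_W _ _ hw.2
    have hi0 : f i = 0 := by
      obtain ⟨y, hy, c, hc, e⟩ := Submodule.mem_sup.1 hfx
      refine map_bigr_eq_zero h' hf hi (y := y - f b) (c := c - f w)
        (sub_mem ⟨h'.F_anti (by omega) hy.1, hy.2⟩ ⟨hf.map_F _ _ hb.1, hf.map_W _ _ hb.2⟩)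
        (sub_mem hc hfw) ?_
      have e2 : f i = f (i + b + w) - f b - f w := by simp only [map_add]; abel
      rw [e2, ← e]; abel
    obtain ⟨y, hy, w', hw', e⟩ := ih (r := r + 1) (by omega) b hb (by
      have := sub_mem hfx (Submodule.mem_sup_right hfw)
      simpa [hi0] using this)
    exact ⟨y, hy, w' + w, add_mem hw' hw.2, by simp [hi0, e]; abel⟩

theorem strict_sup (h : IsTriple W F G) (h' : IsTriple W' F' G') (hf : Respects W F G W' F' G' f)
    {n p : ℤ} {v : V} (hv : f v ∈ F' p ⊔ W' n) :
    ∃ y ∈ F p, ∃ w ∈ W n, f v = f y + f w := by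
  obtain ⟨m₀, hm₀⟩ := h.W_top
  obtain ⟨r₀, hr₀⟩ := h.F_top
  have key : ∀ (m : ℕ) (v : V), v ∈ W (n + m) → f v ∈ F' p ⊔ W' n →
      ∃ y ∈ F p, ∃ w ∈ W n, f v = f y + f w := by
    intro m
    induction m with
    | zero => exact fun v hv _ => ⟨0, zero_mem _, v, by simpa using hv, by simp⟩
    | succ m ih =>
      intro v hv hfv
      have hvF : v ∈ F (min r₀ p) := h.F_anti (min_le_left r₀ p) (by simp [hr₀])
      push_cast at hv
      obtain ⟨a, ha, c, hc, e⟩ := Submodule.mem_sup.1 hfv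
      have hc' : c ∈ W' (n + (m + 1) - 1) := h'.W_mono (by omega) hc
      have haW : a ∈ W' (n + (m + 1)) := by
        have : a = f v - c := by rw [← e]; abel
        rw [this]
        exact sub_mem (hf.map_W _ _ hv) (h'.W_mono (by omega) hc)
      obtain ⟨y, hy, w, hw, e1⟩ := strict_step h h' hf (n := n + (m + 1)) (p := p)
        (p - min r₀ p).toNat (r := min r₀ p) (by omega) v ⟨hvF, hv⟩
        (e ▸ add_mem (Submodule.mem_sup_left ⟨ha, haW⟩) (Submodule.mem_sup_right hc'))
      obtain ⟨y', hy', w', hw', e2⟩ := ih w (by convert hw using 2; ring) (by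
        have : f w = f v - f y := by rw [e1]; abel
        rw [this]
        exact sub_mem hfv (Submodule.mem_sup_left (hf.map_F _ _ hy.1)))
      exact ⟨y + y', add_mem hy.1 hy', w', hw', by rw [e1, e2, map_add]; abel⟩
  refine key (m₀ - n).toNat v ?_ hv
  exact h.W_mono (show m₀ ≤ _ by omega) (by simp [hm₀])

theorem strict_F (h : IsTriple W F G) (h' : IsTriple W' F' G') (hf : Respects W F G W' F' G' f)
    {p : ℤ} {v : V} (hv : f v ∈ F' p) : ∃ y ∈ F p, f y = f v := by
  obtain ⟨n, hn⟩ := h.W_bot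
  obtain ⟨y, hy, w, hw, e⟩ := strict_sup h h' hf (n := n) (Submodule.mem_sup_left hv)
  rw [hn, Submodule.mem_bot] at hw
  exact ⟨y, hy, by simp [e, hw]⟩

theorem strict_W (h : IsTriple W F G) (h' : IsTriple W' F' G') (hf : Respects W F G W' F' G' f)
    {n : ℤ} {v : V} (hv : f v ∈ W' n) : ∃ y ∈ W n, f y = f v := by
  obtain ⟨p, hp⟩ := h.F_bot
  obtain ⟨y, hy, w, hw, e⟩ := strict_sup h h' hf (p := p) (Submodule.mem_sup_right hv)
  rw [hp, Submodule.mem_bot] at hy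
  exact ⟨w, hw, by simp [e, hy]⟩

theorem IsTriple.ker (h : IsTriple W F G) (h' : IsTriple W' F' G')
    (hf : Respects W F G W' F' G' f) {K : Type*} [AddCommGroup K] [Module k K] {i : K →ₗ[k] V}
    (hi : Function.Injective i) (hif : LinearMap.range i = LinearMap.ker f) :
    IsTriple (fun n => (W n).comap i) (fun n => (F n).comap i) (fun n => (G n).comap i) where
  W_mono _ _ e := Submodule.comap_mono (h.W_mono e)
  W_bot := h.W_bot.imp fun n e => by
    simp only [e]; exact (LinearMap.ker_eq_bot.2 hi)
  W_top := h.W_top.imp fun n e => by simp [e]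
  F_anti _ _ e := Submodule.comap_mono (h.F_anti e)
  F_bot := h.F_bot.imp fun n e => by
    simp only [e]; exact (LinearMap.ker_eq_bot.2 hi)
  F_top := h.F_top.imp fun n e => by simp [e]
  G_anti _ _ e := Submodule.comap_mono (h.G_anti e)
  G_bot := h.G_bot.imp fun n e => by
    simp only [e]; exact (LinearMap.ker_eq_bot.2 hi)
  G_top := h.G_top.imp fun n e => by simp [e]
  opposed n p q e := by
    have hlift : ∀ a, f a = 0 → ∃ b, i b = a := fun a ha => by
      have : a ∈ LinearMap.range i := hif ▸ ha
      exact this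
    have hfi : ∀ b, f (i b) = 0 := fun b => by
      have : i b ∈ LinearMap.ker f := hif ▸ LinearMap.mem_range_self i b
      exact this
    have hmono : (W (n - 1)).comap i ≤ (W n).comap i :=
      Submodule.comap_mono (h.W_mono (by omega))
    constructor
    · apply le_antisymm
      · exact sup_le (sup_le inf_le_right hmono) (sup_le inf_le_right hmono)
      · intro x hx
        obtain ⟨a, ha, b, hb, c, hc, ex⟩ := h.decomp e (show i x ∈ W n from hx)
        have e0 : f a + f b + f c = 0 := by rw [← map_add, ← map_add, ← ex, hfi]
        have hfc := hf.map_W _ _ hc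
        obtain ⟨h1, h2⟩ := h'.disj e (a := f a) (b := - f b)
          ⟨hf.map_F _ _ ha.1, hf.map_W _ _ ha.2⟩
          (neg_mem ⟨hf.map_G _ _ hb.1, hf.map_W _ _ hb.2⟩) (by
            have : f a - - f b = - f c := by
              rw [eq_neg_iff_add_eq_zero, ← e0]; abel
            rw [this]; exact neg_mem hfc)
        obtain ⟨a', ha', ea⟩ := strict_gr h h' hf ha h1
        obtain ⟨b', hb', eb⟩ := strict_gr h.swap h'.swap hf.swap hb (by simpa using h2)
        obtain ⟨u, hu⟩ := hlift (a - a') (by simp [ea])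
        obtain ⟨v, hv⟩ := hlift (b - b') (by simp [eb])
        have hx' : x = u + v + (x - u - v) := by abel
        rw [hx']
        have hn := h.W_mono (show n - 1 ≤ n by omega)
        refine add_mem (add_mem ?_ ?_) ?_
        · refine Submodule.mem_sup_left (Submodule.mem_sup_left ?_)
          have : i u ∈ F p ⊓ W n := by
            rw [hu]; exact sub_mem ha ⟨ha'.1, hn ha'.2⟩
          exact this
        · refine Submodule.mem_sup_right (Submodule.mem_sup_left ?_)
          have : i v ∈ G q ⊓ W n := by
            rw [hv]; exact sub_mem hb ⟨hb'.1, hn hb'.2⟩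
          exact this
        · refine Submodule.mem_sup_left (Submodule.mem_sup_right ?_)
          rw [Submodule.mem_comap, map_sub, map_sub, hu, hv, ex]
          have : a + b + c - (a - a') - (b - b') = c + a' + b' := by abel
          rw [this]
          exact add_mem (add_mem hc ha'.2) hb'.2
    · apply le_antisymm
      · rintro x ⟨hx1, hx2⟩
        have m1 : (F p).comap i ⊓ (W n).comap i ⊔ (W (n - 1)).comap i ≤
            (F p ⊓ W n ⊔ W (n - 1)).comap i :=
          sup_le (fun y hy => Submodule.mem_sup_left hy) (fun y hy => Submodule.mem_sup_right hy)
        have m2 : (G q).comap i ⊓ (W n).comap i ⊔ (W (n - 1)).comap i ≤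
            (G q ⊓ W n ⊔ W (n - 1)).comap i :=
          sup_le (fun y hy => Submodule.mem_sup_left hy) (fun y hy => Submodule.mem_sup_right hy)
        have : i x ∈ W (n - 1) := by
          rw [← (h.opposed n p q e).2]; exact ⟨m1 hx1, m2 hx2⟩
        exact this
      · exact le_inf le_sup_right le_sup_right

theorem map_F_inf_W (h : IsTriple W F G) (h' : IsTriple W' F' G')
    (hf : Respects W F G W' F' G' f) {Q : Type*} [AddCommGroup Q] [Module k Q] {π : V' →ₗ[k] Q}
    (hfπ : LinearMap.range f = LinearMap.ker π) (p n : ℤ) :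
    (F' p).map π ⊓ (W' n).map π = (F' p ⊓ W' n).map π := by
  apply le_antisymm
  · rintro _ ⟨⟨x, hx, rfl⟩, ⟨y, hy, e⟩⟩
    have : x - y ∈ LinearMap.range f := by
      rw [hfπ]; simp [e]
    obtain ⟨v, hv⟩ := this
    obtain ⟨v1, h1, v2, h2, e2⟩ := strict_sup h h' hf (p := p) (n := n) (v := v) (by
      rw [hv]; exact sub_mem (Submodule.mem_sup_left hx) (Submodule.mem_sup_right hy))
    have hπ : ∀ v, π (f v) = 0 := fun v => by
      have : f v ∈ LinearMap.ker π := hfπ ▸ LinearMap.mem_range_self f v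
      exact this
    refine ⟨x - f v1, ⟨sub_mem hx (hf.map_F _ _ h1), ?_⟩, by simp [hπ]⟩
    have : x - f v1 = y + f v2 := by
      have : x = y + f v := by rw [hv]; abel
      rw [this, e2]; abel
    rw [this]
    exact add_mem hy (hf.map_W _ _ h2)
  · exact le_inf (Submodule.map_mono inf_le_left) (Submodule.map_mono inf_le_right)

theorem IsTriple.coker (h : IsTriple W F G) (h' : IsTriple W' F' G')
    (hf : Respects W F G W' F' G' f) {Q : Type*} [AddCommGroup Q] [Module k Q] {π : V' →ₗ[k] Q}
    (hπ : Function.Surjective π) (hfπ : LinearMap.range f = LinearMap.ker π) :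
    IsTriple (fun n => (W' n).map π) (fun n => (F' n).map π) (fun n => (G' n).map π) where
  W_mono _ _ e := Submodule.map_mono (h'.W_mono e)
  W_bot := h'.W_bot.imp fun n e => by simp [e]
  W_top := h'.W_top.imp fun n e => by simp [e, LinearMap.range_eq_top.2 hπ]
  F_anti _ _ e := Submodule.map_mono (h'.F_anti e)
  F_bot := h'.F_bot.imp fun n e => by simp [e]
  F_top := h'.F_top.imp fun n e => by simp [e, LinearMap.range_eq_top.2 hπ]
  G_anti _ _ e := Submodule.map_mono (h'.G_anti e)
  G_bot := h'.G_bot.imp fun n e => by simp [e]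
  G_top := h'.G_top.imp fun n e => by simp [e, LinearMap.range_eq_top.2 hπ]
  opposed n p q e := by
    simp only [map_F_inf_W h h' hf hfπ, map_F_inf_W h.swap h'.swap hf.swap hfπ]
    simp only [← Submodule.map_sup]
    refine ⟨by rw [(h'.opposed n p q e).1], le_antisymm ?_ ?_⟩
    · rintro _ ⟨⟨x, hx, rfl⟩, ⟨y, hy, exy⟩⟩
      obtain ⟨a, ha, c, hc, rfl⟩ := Submodule.mem_sup.1 hx
      obtain ⟨b, hb, d, hd, rfl⟩ := Submodule.mem_sup.1 hy
      have : (a + c) - (b + d) ∈ LinearMap.range f := by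
        rw [hfπ, LinearMap.mem_ker, map_sub, exy, sub_self]
      obtain ⟨v, hv⟩ := this
      have hn := h'.W_mono (show n - 1 ≤ n by omega)
      obtain ⟨v', hv', ev⟩ := strict_W h h' hf (n := n) (v := v) (by
        rw [hv]; exact sub_mem (add_mem ha.2 (hn hc)) (add_mem hb.2 (hn hd)))
      obtain ⟨v1, h1, v2, h2, w, hw, rfl⟩ := h.decomp e hv'
      have hfw := hf.map_W _ _ hw
      obtain ⟨h3, -⟩ := h'.disj e (a := a - f v1) (b := b + f v2)
        (sub_mem ha ⟨hf.map_F _ _ h1.1, hf.map_W _ _ h1.2⟩)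
        (add_mem hb ⟨hf.map_G _ _ h2.1, hf.map_W _ _ h2.2⟩) (by
          have e3 : f v1 + f v2 + f w = (a + c) - (b + d) := by
            rw [← hv, ← ev]; simp
          have : a - f v1 - (b + f v2) = f w - c + d := by
            have : a = f v1 + f v2 + f w + (b + d) - c := by rw [e3]; abel
            rw [this]; abel
          rw [this]
          exact add_mem (sub_mem hfw hc) hd)
      refine ⟨a - f v1 + c, add_mem h3 hc, ?_⟩
      have : f v1 ∈ LinearMap.ker π := hfπ ▸ LinearMap.mem_range_self f v1
      simp [LinearMap.mem_ker.1 this]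
    · exact le_inf (Submodule.map_mono le_sup_right) (Submodule.map_mono le_sup_right)

theorem IsTriple.prod (h : IsTriple W F G) (h' : IsTriple W' F' G') {P : Type*} [AddCommGroup P]
    [Module k P] {p₁ : P →ₗ[k] V} {p₂ : P →ₗ[k] V'} {i₁ : V →ₗ[k] P} {i₂ : V' →ₗ[k] P}
    (h₁₁ : ∀ x, p₁ (i₁ x) = x) (h₁₂ : ∀ x, p₂ (i₁ x) = 0) (h₂₁ : ∀ x, p₁ (i₂ x) = 0)
    (h₂₂ : ∀ x, p₂ (i₂ x) = x) (hid : ∀ x, i₁ (p₁ x) + i₂ (p₂ x) = x) :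
    IsTriple (fun n => (W n).comap p₁ ⊓ (W' n).comap p₂)
      (fun n => (F n).comap p₁ ⊓ (F' n).comap p₂) (fun n => (G n).comap p₁ ⊓ (G' n).comap p₂) := by
  have hbot : (⊥ : Submodule k V).comap p₁ ⊓ (⊥ : Submodule k V').comap p₂ = ⊥ := by
    rw [eq_bot_iff]
    rintro x ⟨h1, h2⟩
    have h1' : p₁ x = 0 := h1
    have h2' : p₂ x = 0 := h2
    rw [Submodule.mem_bot, ← hid x, h1', h2']; simp
  constructor
  · exact fun a b e => inf_le_inf (Submodule.comap_mono (h.W_mono e))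
      (Submodule.comap_mono (h'.W_mono e))
  · obtain ⟨a, ha⟩ := h.W_bot
    obtain ⟨b, hb⟩ := h'.W_bot
    have h1 := h.W_mono (min_le_left a b)
    have h2 := h'.W_mono (min_le_right a b)
    rw [ha, le_bot_iff] at h1
    rw [hb, le_bot_iff] at h2
    exact ⟨min a b, by simp only [h1, h2, hbot]⟩
  · obtain ⟨a, ha⟩ := h.W_top
    obtain ⟨b, hb⟩ := h'.W_top
    have h1 := h.W_mono (le_max_left a b)
    have h2 := h'.W_mono (le_max_right a b)
    rw [ha, top_le_iff] at h1
    rw [hb, top_le_iff] at h2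
    exact ⟨max a b, by simp [h1, h2]⟩
  · exact fun a b e => inf_le_inf (Submodule.comap_mono (h.F_anti e))
      (Submodule.comap_mono (h'.F_anti e))
  · obtain ⟨a, ha⟩ := h.F_bot
    obtain ⟨b, hb⟩ := h'.F_bot
    have h1 := h.F_anti (le_max_left a b)
    have h2 := h'.F_anti (le_max_right a b)
    rw [ha, le_bot_iff] at h1
    rw [hb, le_bot_iff] at h2
    exact ⟨max a b, by simp only [h1, h2, hbot]⟩
  · obtain ⟨a, ha⟩ := h.F_top
    obtain ⟨b, hb⟩ := h'.F_top
    have h1 := h.F_anti (min_le_left a b)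
    have h2 := h'.F_anti (min_le_right a b)
    rw [ha, top_le_iff] at h1
    rw [hb, top_le_iff] at h2
    exact ⟨min a b, by simp [h1, h2]⟩
  · exact fun a b e => inf_le_inf (Submodule.comap_mono (h.G_anti e))
      (Submodule.comap_mono (h'.G_anti e))
  · obtain ⟨a, ha⟩ := h.G_bot
    obtain ⟨b, hb⟩ := h'.G_bot
    have h1 := h.G_anti (le_max_left a b)
    have h2 := h'.G_anti (le_max_right a b)
    rw [ha, le_bot_iff] at h1
    rw [hb, le_bot_iff] at h2
    exact ⟨max a b, by simp only [h1, h2, hbot]⟩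
  · obtain ⟨a, ha⟩ := h.G_top
    obtain ⟨b, hb⟩ := h'.G_top
    have h1 := h.G_anti (min_le_left a b)
    have h2 := h'.G_anti (min_le_right a b)
    rw [ha, top_le_iff] at h1
    rw [hb, top_le_iff] at h2
    exact ⟨min a b, by simp [h1, h2]⟩
  · intro n p q e
    have mk : ∀ {A : Submodule k V} {B : Submodule k V'} {a b}, a ∈ A → b ∈ B →
        i₁ a + i₂ b ∈ A.comap p₁ ⊓ B.comap p₂ := fun ha hb =>
      ⟨by simpa [h₁₁, h₂₁] using ha, by simpa [h₁₂, h₂₂] using hb⟩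
    have hm : (W (n - 1)).comap p₁ ⊓ (W' (n - 1)).comap p₂ ≤ (W n).comap p₁ ⊓ (W' n).comap p₂ :=
      inf_le_inf (Submodule.comap_mono (h.W_mono (by omega)))
        (Submodule.comap_mono (h'.W_mono (by omega)))
    constructor
    · refine le_antisymm (sup_le (sup_le inf_le_right hm) (sup_le inf_le_right hm)) ?_
      rintro x ⟨hx1, hx2⟩
      obtain ⟨a, ha, b, hb, c, hc, e1⟩ := h.decomp e hx1
      obtain ⟨a', ha', b', hb', c', hc', e2⟩ := h'.decomp e hx2
      have : x = (i₁ a + i₂ a') + (i₁ b + i₂ b') + (i₁ c + i₂ c') := by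
        rw [← hid x, e1, e2]; simp only [map_add]; abel
      rw [this]
      refine add_mem (add_mem ?_ ?_) ?_
      · exact Submodule.mem_sup_left (Submodule.mem_sup_left ⟨mk ha.1 ha'.1, mk ha.2 ha'.2⟩)
      · exact Submodule.mem_sup_right (Submodule.mem_sup_left ⟨mk hb.1 hb'.1, mk hb.2 hb'.2⟩)
      · exact Submodule.mem_sup_right (Submodule.mem_sup_right (mk hc hc'))
    · refine le_antisymm ?_ (le_inf le_sup_right le_sup_right)
      have sub : ∀ (A B C : Submodule k V) (A' B' C' : Submodule k V'),
          (A.comap p₁ ⊓ A'.comap p₂) ⊓ (B.comap p₁ ⊓ B'.comap p₂) ⊔ (C.comap p₁ ⊓ C'.comap p₂) ≤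
          (A ⊓ B ⊔ C).comap p₁ ⊓ (A' ⊓ B' ⊔ C').comap p₂ := fun A B C A' B' C' =>
        sup_le (fun y hy => ⟨Submodule.mem_sup_left ⟨hy.1.1, hy.2.1⟩,
            Submodule.mem_sup_left ⟨hy.1.2, hy.2.2⟩⟩)
          (fun y hy => ⟨Submodule.mem_sup_right hy.1, Submodule.mem_sup_right hy.2⟩)
      rintro x ⟨hx1, hx2⟩
      obtain ⟨a1, a2⟩ := sub _ _ _ _ _ _ hx1
      obtain ⟨b1, b2⟩ := sub _ _ _ _ _ _ hx2
      refine ⟨?_, ?_⟩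
      · have : p₁ x ∈ W (n - 1) := by rw [← (h.opposed n p q e).2]; exact ⟨a1, b1⟩
        exact this
      · have : p₂ x ∈ W' (n - 1) := by rw [← (h'.opposed n p q e).2]; exact ⟨a2, b2⟩
        exact this

end Filtrations

section BaseChange

variable {V V' : Type*} [AddCommGroup V] [Module ℚ V] [AddCommGroup V'] [Module ℚ V']

theorem mem_baseChange_map {P : Submodule ℚ V} {Q : Submodule ℚ V'} {f : V →ₗ[ℚ] V'}
    (h : ∀ x ∈ P, f x ∈ Q) (x : ℂ ⊗[ℚ] V) (hx : x ∈ P.baseChange ℂ) :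
    f.baseChange ℂ x ∈ Q.baseChange ℂ := by
  obtain ⟨y, rfl⟩ := hx
  induction y with
  | zero => simp
  | add a b ha hb => simpa using add_mem ha hb
  | tmul z v =>
    simpa using Submodule.tmul_mem_baseChange_of_mem z (h _ v.2)

theorem ker_baseChange_eq {V'' : Type*} [AddCommGroup V''] [Module ℚ V''] {f : V →ₗ[ℚ] V'}
    {g : V' →ₗ[ℚ] V''} (h : LinearMap.range f = LinearMap.ker g) :
    LinearMap.range (f.baseChange ℂ) = LinearMap.ker (g.baseChange ℂ) := by
  have h1 : Function.Exact f g := (LinearMap.exact_iff).2 h.symm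
  have h2 := Module.Flat.lTensor_exact ℂ h1
  ext x
  exact (h2 x).symm

theorem comap_baseChange (P : Submodule ℚ V') (f : V →ₗ[ℚ] V') :
    (P.comap f).baseChange ℂ = (P.baseChange ℂ).comap (f.baseChange ℂ) := by
  have h1 : LinearMap.range (P.comap f).subtype = LinearMap.ker (P.mkQ ∘ₗ f) := by
    rw [Submodule.range_subtype, LinearMap.ker_comp, Submodule.ker_mkQ]
  have h2 : LinearMap.range P.subtype = LinearMap.ker P.mkQ := by
    rw [Submodule.range_subtype, Submodule.ker_mkQ]
  unfold Submodule.baseChange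
  rw [ker_baseChange_eq h1, ker_baseChange_eq h2, LinearMap.baseChange_comp, LinearMap.ker_comp]

theorem map_baseChange (P : Submodule ℚ V) (f : V →ₗ[ℚ] V') :
    (P.map f).baseChange ℂ = (P.baseChange ℂ).map (f.baseChange ℂ) := by
  apply le_antisymm
  · rw [Submodule.baseChange_eq_span, Submodule.span_le]
    rintro _ ⟨_, ⟨x, hx, rfl⟩, rfl⟩
    exact ⟨1 ⊗ₜ x, Submodule.tmul_mem_baseChange_of_mem 1 hx, by simp⟩
  · rw [Submodule.map_le_iff_le_comap]
    exact fun x hx => mem_baseChange_map (fun y hy => Submodule.mem_map_of_mem hy) x hx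

/-- Complex conjugation on `V_ℂ = ℂ ⊗ V`, i.e. `z ⊗ v ↦ z̄ ⊗ v`. -/
noncomputable def conjC (V : Type*) [AddCommGroup V] [Module ℚ V] :
    ℂ ⊗[ℚ] V →ₛₗ[starRingEnd ℂ] ℂ ⊗[ℚ] V where
  toFun := (Complex.conjAe.toLinearMap.restrictScalars ℚ).rTensor V
  map_add' := map_add _
  map_smul' c x := by
    induction x with
    | zero => simp
    | add a b ha hb => rw [smul_add, map_add, map_add, smul_add, ha, hb]
    | tmul z v => simp [TensorProduct.smul_tmul']

@[simp]
theorem conjC_tmul (z : ℂ) (v : V) : conjC V (z ⊗ₜ v) = (starRingEnd ℂ z) ⊗ₜ v := rfl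

@[simp]
theorem conjC_conjC (x : ℂ ⊗[ℚ] V) : conjC V (conjC V x) = x := by
  induction x with
  | zero => simp
  | add a b ha hb => rw [map_add, map_add, ha, hb]
  | tmul z v => simp

theorem conjC_baseChange (f : V →ₗ[ℚ] V') (x : ℂ ⊗[ℚ] V) :
    conjC V' (f.baseChange ℂ x) = f.baseChange ℂ (conjC V x) := by
  induction x with
  | zero => simp
  | add a b ha hb => simp only [map_add, ha, hb]
  | tmul z v => simp

/-- The complex conjugate of a subspace of `V_ℂ`. -/
noncomputable def conjSub (P : Submodule ℂ (ℂ ⊗[ℚ] V)) : Submodule ℂ (ℂ ⊗[ℚ] V) :=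
  P.comap (conjC V)

theorem mem_conjSub {P : Submodule ℂ (ℂ ⊗[ℚ] V)} {x : ℂ ⊗[ℚ] V} :
    x ∈ conjSub P ↔ conjC V x ∈ P := Iff.rfl

theorem conjSub_top : conjSub (⊤ : Submodule ℂ (ℂ ⊗[ℚ] V)) = ⊤ := rfl

theorem conjSub_bot : conjSub (⊥ : Submodule ℂ (ℂ ⊗[ℚ] V)) = ⊥ := by
  rw [eq_bot_iff]
  intro x hx
  have h : conjC V x = 0 := hx
  rw [Submodule.mem_bot, ← conjC_conjC x, h, map_zero]

theorem conjSub_inf (P Q : Submodule ℂ (ℂ ⊗[ℚ] V)) : conjSub (P ⊓ Q) = conjSub P ⊓ conjSub Q := rfl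

theorem conjSub_comap (P : Submodule ℂ (ℂ ⊗[ℚ] V')) (f : V →ₗ[ℚ] V') :
    conjSub (P.comap (f.baseChange ℂ)) = (conjSub P).comap (f.baseChange ℂ) := by
  ext x
  simp only [mem_conjSub, Submodule.mem_comap, conjC_baseChange]

theorem conjSub_map (P : Submodule ℂ (ℂ ⊗[ℚ] V)) (f : V →ₗ[ℚ] V') :
    conjSub (P.map (f.baseChange ℂ)) = (conjSub P).map (f.baseChange ℂ) := by
  ext x
  simp only [mem_conjSub, Submodule.mem_map]
  constructor
  · rintro ⟨y, hy, e⟩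
    exact ⟨conjC V y, by rwa [conjC_conjC], by rw [← conjC_baseChange, e, conjC_conjC]⟩
  · rintro ⟨y, hy, rfl⟩
    exact ⟨conjC V y, hy, (conjC_baseChange f y).symm⟩

variable {K K' : Type*} [AddCommGroup K] [Module ℚ K] [AddCommGroup K'] [Module ℚ K']

theorem baseChange_comm {f : V →ₗ[ℚ] V'} {g : K →ₗ[ℚ] K'} {i : V →ₗ[ℚ] K} {i' : V' →ₗ[ℚ] K'}
    (e : ∀ v, i' (f v) = g (i v)) (x : ℂ ⊗[ℚ] V) :
    i'.baseChange ℂ (f.baseChange ℂ x) = g.baseChange ℂ (i.baseChange ℂ x) := by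
  induction x with
  | zero => simp
  | add a b ha hb => simp only [map_add, ha, hb]
  | tmul z v => simp [e]

theorem conj_comap {f : V →ₗ[ℚ] V'} {g : K →ₗ[ℚ] K'} {i : V →ₗ[ℚ] K} {i' : V' →ₗ[ℚ] K'}
    (e : ∀ v, i' (f v) = g (i v)) {P : Submodule ℂ (ℂ ⊗[ℚ] K)} {P' : Submodule ℂ (ℂ ⊗[ℚ] K')}
    (h : ∀ x ∈ P, g.baseChange ℂ x ∈ conjSub P') (x : ℂ ⊗[ℚ] V)
    (hx : x ∈ P.comap (i.baseChange ℂ)) :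
    f.baseChange ℂ x ∈ conjSub (P'.comap (i'.baseChange ℂ)) := by
  rw [conjSub_comap, Submodule.mem_comap, baseChange_comm e]
  exact h _ hx

theorem conj_map {f : V →ₗ[ℚ] V'} {g : K →ₗ[ℚ] K'} {i : V →ₗ[ℚ] K} {i' : V' →ₗ[ℚ] K'}
    (e : ∀ v, i' (f v) = g (i v)) {P : Submodule ℂ (ℂ ⊗[ℚ] V)} {P' : Submodule ℂ (ℂ ⊗[ℚ] V')}
    (h : ∀ x ∈ P, f.baseChange ℂ x ∈ conjSub P') (x : ℂ ⊗[ℚ] K)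
    (hx : x ∈ P.map (i.baseChange ℂ)) :
    g.baseChange ℂ x ∈ conjSub (P'.map (i'.baseChange ℂ)) := by
  obtain ⟨y, hy, rfl⟩ := hx
  rw [conjSub_map, ← baseChange_comm e]
  exact ⟨_, h _ hy, rfl⟩

theorem map_ite (f : V →ₗ[ℚ] V') (c : Prop) [Decidable c] (x : V)
    (hx : x ∈ (if c then ⊤ else ⊥ : Submodule ℚ V)) :
    f x ∈ (if c then ⊤ else ⊥ : Submodule ℚ V') := by
  split_ifs with h
  · trivial
  · rw [if_neg h, Submodule.mem_bot] at hx
    rw [hx, map_zero]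
    exact zero_mem _

theorem conj_ite (f : V →ₗ[ℚ] V') (c : Prop) [Decidable c] (x : ℂ ⊗[ℚ] V)
    (hx : x ∈ (if c then ⊤ else ⊥ : Submodule ℂ (ℂ ⊗[ℚ] V))) :
    f.baseChange ℂ x ∈ conjSub (if c then ⊤ else ⊥ : Submodule ℂ (ℂ ⊗[ℚ] V')) := by
  split_ifs with h
  · trivial
  · rw [if_neg h, Submodule.mem_bot] at hx
    rw [hx, map_zero]
    exact zero_mem _

theorem inl_mem {P : Submodule ℂ (ℂ ⊗[ℚ] V)} {Q : Submodule ℂ (ℂ ⊗[ℚ] V')} {x : ℂ ⊗[ℚ] V}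
    (hx : x ∈ P) : (LinearMap.inl ℚ V V').baseChange ℂ x ∈
      P.comap ((LinearMap.fst ℚ V V').baseChange ℂ) ⊓
        Q.comap ((LinearMap.snd ℚ V V').baseChange ℂ) := by
  refine ⟨?_, ?_⟩
  · change (LinearMap.fst ℚ V V').baseChange ℂ _ ∈ P
    rw [← LinearMap.comp_apply, ← LinearMap.baseChange_comp]; simpa using hx
  · change (LinearMap.snd ℚ V V').baseChange ℂ _ ∈ Q
    rw [← LinearMap.comp_apply, ← LinearMap.baseChange_comp]; simp

theorem inr_mem {P : Submodule ℂ (ℂ ⊗[ℚ] V)} {Q : Submodule ℂ (ℂ ⊗[ℚ] V')} {x : ℂ ⊗[ℚ] V'}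
    (hx : x ∈ Q) : (LinearMap.inr ℚ V V').baseChange ℂ x ∈
      P.comap ((LinearMap.fst ℚ V V').baseChange ℂ) ⊓
        Q.comap ((LinearMap.snd ℚ V V').baseChange ℂ) := by
  refine ⟨?_, ?_⟩
  · change (LinearMap.fst ℚ V V').baseChange ℂ _ ∈ P
    rw [← LinearMap.comp_apply, ← LinearMap.baseChange_comp]; simp
  · change (LinearMap.snd ℚ V V').baseChange ℂ _ ∈ Q
    rw [← LinearMap.comp_apply, ← LinearMap.baseChange_comp]; simpa using hx

end BaseChange

/-- A mixed `ℚ`-Hodge structure: a finite dimensional `ℚ`-vector space `V` with a finite increasing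
(weight) filtration `W` of `V` and a finite decreasing (Hodge) filtration `F` of `V_ℂ = ℂ ⊗ V` such
that `F` and its complex conjugate induce `n`-opposed filtrations on `(Gr^W_n V)_ℂ` for all `n`. -/
structure MHS where
  V : Type
  [addCommGroup : AddCommGroup V]
  [module : Module ℚ V]
  [finite : Module.Finite ℚ V]
  W : ℤ → Submodule ℚ V
  W_mono : Monotone W
  W_bot : ∃ n, W n = ⊥
  W_top : ∃ n, W n = ⊤
  F : ℤ → Submodule ℂ (ℂ ⊗[ℚ] V)
  F_anti : Antitone F
  F_bot : ∃ p, F p = ⊥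
  F_top : ∃ p, F p = ⊤
  opposed : Opposed (fun n => (W n).baseChange ℂ) F (fun p => conjSub (F p))

namespace MHS

attribute [instance] MHS.addCommGroup MHS.module MHS.finite

theorem isTriple (M : MHS) :
    IsTriple (fun n => (M.W n).baseChange ℂ) M.F (fun p => conjSub (M.F p)) where
  W_mono _ _ e := Submodule.baseChange_mono ℂ (M.W_mono e)
  W_bot := M.W_bot.imp fun n e => by simp [e]
  W_top := M.W_top.imp fun n e => by simp [e]
  F_anti := M.F_anti
  F_bot := M.F_bot
  F_top := M.F_top
  G_anti _ _ e := Submodule.comap_mono (M.F_anti e)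
  G_bot := M.F_bot.imp fun n e => by simp [e, conjSub_bot]
  G_top := M.F_top.imp fun n e => by simp [e, conjSub_top]
  opposed := M.opposed

/-- Morphisms of mixed Hodge structures: `ℚ`-linear maps that respect both filtrations. -/
structure IsMor (M N : MHS) (f : M.V →ₗ[ℚ] N.V) : Prop where
  map_W : ∀ n x, x ∈ M.W n → f x ∈ N.W n
  map_F : ∀ p x, x ∈ M.F p → f.baseChange ℂ x ∈ N.F p

variable {M N : MHS} {f : M.V →ₗ[ℚ] N.V}

theorem IsMor.respects (hf : IsMor M N f) :
    Respects (fun n => (M.W n).baseChange ℂ) M.F (fun p => conjSub (M.F p))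
      (fun n => (N.W n).baseChange ℂ) N.F (fun p => conjSub (N.F p)) (f.baseChange ℂ) where
  map_W n := mem_baseChange_map (hf.map_W n)
  map_F := hf.map_F
  map_G p x hx := by
    rw [mem_conjSub, conjC_baseChange]
    exact hf.map_F p _ hx

theorem IsMor.le_comap_of_injective (hf : IsMor M N f) (hi : Function.Injective f) :
    (∀ n, (N.W n).comap f ≤ M.W n) ∧ ∀ p, (N.F p).comap (f.baseChange ℂ) ≤ M.F p := by
  have hC : Function.Injective (f.baseChange ℂ) :=
    Module.Flat.lTensor_preserves_injective_linearMap (M := ℂ) f hi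
  refine ⟨fun n => ?_, fun p x hx => ?_⟩
  · rw [← Submodule.baseChange_le_iff (A := ℂ), comap_baseChange]
    intro x hx
    obtain ⟨y, hy, e⟩ := strict_W M.isTriple N.isTriple hf.respects (n := n) hx
    exact hC e ▸ hy
  · obtain ⟨y, hy, e⟩ := strict_F M.isTriple N.isTriple hf.respects (p := p) hx
    exact hC e ▸ hy

theorem IsMor.le_map_of_surjective (hf : IsMor M N f) (hs : Function.Surjective f) :
    (∀ n, N.W n ≤ (M.W n).map f) ∧ ∀ p, N.F p ≤ (M.F p).map (f.baseChange ℂ) := by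
  have hC : Function.Surjective (f.baseChange ℂ) := LinearMap.lTensor_surjective ℂ hs
  refine ⟨fun n => ?_, fun p x hx => ?_⟩
  · rw [← Submodule.baseChange_le_iff (A := ℂ), map_baseChange]
    intro x hx
    obtain ⟨y, rfl⟩ := hC x
    exact strict_W M.isTriple N.isTriple hf.respects (n := n) hx
  · obtain ⟨y, rfl⟩ := hC x
    exact strict_F M.isTriple N.isTriple hf.respects (p := p) hx

/-- The kernel of a morphism, with the induced filtrations. -/
noncomputable def ker (f : M.V →ₗ[ℚ] N.V) (hf : IsMor M N f) : MHS :=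
  have h := IsTriple.ker M.isTriple N.isTriple hf.respects
    (i := (LinearMap.ker f).subtype.baseChange ℂ)
    (Module.Flat.lTensor_preserves_injective_linearMap (M := ℂ) _ (Submodule.subtype_injective _))
    (ker_baseChange_eq (Submodule.range_subtype _))
  { V := LinearMap.ker f
    W := fun n => (M.W n).comap (LinearMap.ker f).subtype
    W_mono := fun _ _ e => Submodule.comap_mono (M.W_mono e)
    W_bot := M.W_bot.imp fun n e => by
      rw [e]; exact LinearMap.ker_eq_bot.2 (Submodule.subtype_injective _)
    W_top := M.W_top.imp fun n e => by rw [e, Submodule.comap_top]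
    F := fun p => (M.F p).comap ((LinearMap.ker f).subtype.baseChange ℂ)
    F_anti := h.F_anti
    F_bot := h.F_bot
    F_top := h.F_top
    opposed := by
      simpa only [comap_baseChange, conjSub_comap] using h.opposed }

/-- The cokernel of a morphism, with the quotient filtrations. -/
noncomputable def coker (f : M.V →ₗ[ℚ] N.V) (hf : IsMor M N f) : MHS :=
  have h := IsTriple.coker M.isTriple N.isTriple hf.respects
    (π := (LinearMap.range f).mkQ.baseChange ℂ)
    (LinearMap.lTensor_surjective ℂ (Submodule.mkQ_surjective _))
    (ker_baseChange_eq (Submodule.ker_mkQ _).symm)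
  { V := N.V ⧸ LinearMap.range f
    W := fun n => (N.W n).map (LinearMap.range f).mkQ
    W_mono := fun _ _ e => Submodule.map_mono (N.W_mono e)
    W_bot := N.W_bot.imp fun n e => by rw [e, Submodule.map_bot]
    W_top := N.W_top.imp fun n e => by rw [e, Submodule.map_top, Submodule.range_mkQ]
    F := fun p => (N.F p).map ((LinearMap.range f).mkQ.baseChange ℂ)
    F_anti := h.F_anti
    F_bot := h.F_bot
    F_top := h.F_top
    opposed := by
      simpa only [map_baseChange, conjSub_map] using h.opposed }

theorem prod_W (P : Submodule ℚ M.V) (Q : Submodule ℚ N.V) :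
    (P.comap (LinearMap.fst ℚ M.V N.V) ⊓ Q.comap (LinearMap.snd ℚ M.V N.V)).baseChange ℂ =
      (P.baseChange ℂ).comap ((LinearMap.fst ℚ M.V N.V).baseChange ℂ) ⊓
        (Q.baseChange ℂ).comap ((LinearMap.snd ℚ M.V N.V).baseChange ℂ) := by
  apply le_antisymm
  · exact le_inf (fun x hx => mem_baseChange_map (f := LinearMap.fst ℚ M.V N.V) (Q := P)
      (fun y (hy : _ ∧ _) => hy.1) x hx) (fun x hx => mem_baseChange_map
      (f := LinearMap.snd ℚ M.V N.V) (Q := Q) (fun y (hy : _ ∧ _) => hy.2) x hx)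
  · rintro x ⟨h1, h2⟩
    have : x = (LinearMap.inl ℚ M.V N.V).baseChange ℂ ((LinearMap.fst ℚ M.V N.V).baseChange ℂ x) +
        (LinearMap.inr ℚ M.V N.V).baseChange ℂ ((LinearMap.snd ℚ M.V N.V).baseChange ℂ x) := by
      clear h1 h2
      induction x with
      | zero => simp
      | add a b ha hb =>
        simp only [map_add]
        nth_rw 1 [ha, hb]
        abel
      | tmul z v => simp [← TensorProduct.tmul_add]
    rw [this]
    refine add_mem (mem_baseChange_map (fun y hy => ?_) _ h1)
      (mem_baseChange_map (fun y hy => ?_) _ h2)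
    · exact ⟨hy, Q.zero_mem⟩
    · exact ⟨P.zero_mem, hy⟩

/-- The direct sum of two mixed Hodge structures. -/
noncomputable def prod (M N : MHS) : MHS :=
  have h := IsTriple.prod M.isTriple N.isTriple (P := ℂ ⊗[ℚ] (M.V × N.V))
    (p₁ := (LinearMap.fst ℚ M.V N.V).baseChange ℂ) (p₂ := (LinearMap.snd ℚ M.V N.V).baseChange ℂ)
    (i₁ := (LinearMap.inl ℚ M.V N.V).baseChange ℂ) (i₂ := (LinearMap.inr ℚ M.V N.V).baseChange ℂ)
    (fun x => by rw [← LinearMap.comp_apply, ← LinearMap.baseChange_comp]; simp)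
    (fun x => by rw [← LinearMap.comp_apply, ← LinearMap.baseChange_comp]; simp)
    (fun x => by rw [← LinearMap.comp_apply, ← LinearMap.baseChange_comp]; simp)
    (fun x => by rw [← LinearMap.comp_apply, ← LinearMap.baseChange_comp]; simp)
    (fun x => by
      induction x with
      | zero => simp
      | add a b ha hb =>
        simp only [map_add]
        nth_rw 3 [← ha, ← hb]
        abel
      | tmul z v => simp [← TensorProduct.tmul_add])
  { V := M.V × N.V
    W := fun n => (M.W n).comap (LinearMap.fst ℚ M.V N.V) ⊓ (N.W n).comap (LinearMap.snd ℚ M.V N.V)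
    W_mono := fun _ _ e => inf_le_inf (Submodule.comap_mono (M.W_mono e))
      (Submodule.comap_mono (N.W_mono e))
    W_bot := h.W_bot.imp fun n e => by
      simp only [← prod_W] at e
      exact Submodule.baseChange_injective (A := ℂ)
        (e.trans (Submodule.baseChange_bot ℂ).symm)
    W_top := h.W_top.imp fun n e => by
      simp only [← prod_W] at e
      exact Submodule.baseChange_injective (A := ℂ)
        (e.trans (Submodule.baseChange_top ℂ).symm)
    F := fun p => (M.F p).comap ((LinearMap.fst ℚ M.V N.V).baseChange ℂ) ⊓
      (N.F p).comap ((LinearMap.snd ℚ M.V N.V).baseChange ℂ)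
    F_anti := h.F_anti
    F_bot := h.F_bot
    F_top := h.F_top
    opposed := by
      simpa only [prod_W, conjSub_comap, conjSub_inf] using h.opposed }

/-- The Hodge structure of type `(a, a)` on a finite dimensional `ℚ`-vector space. -/
noncomputable def ofType (V : Type) [AddCommGroup V] [Module ℚ V] [Module.Finite ℚ V] (a : ℤ) :
    MHS where
  V := V
  W n := if 2 * a ≤ n then ⊤ else ⊥
  W_mono m n h := by
    dsimp only
    split_ifs <;> first | exact le_rfl | exact bot_le | exact le_top | omega
  W_bot := ⟨2 * a - 1, by simp⟩
  W_top := ⟨2 * a, by simp⟩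
  F p := if p ≤ a then ⊤ else ⊥
  F_anti m n h := by
    dsimp only
    split_ifs <;> first | exact le_rfl | exact bot_le | exact le_top | omega
  F_bot := ⟨a + 1, by simp⟩
  F_top := ⟨a, by simp⟩
  opposed n p q e := by
    dsimp only
    split_ifs <;> first | (simp [conjSub_top, conjSub_bot]; done) | omega

end MHS

section Variations

set_option linter.unusedVariables false

variable (A : Type u) [CommRing A] [Algebra ℝ A]

/-- The set `X(ℂ)` of complex points of the `ℝ`-scheme `X = Spec A`. -/
abbrev Points : Type u := A →ₐ[ℝ] ℂ

variable {A} in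
/-- The involution `ι` of `X(ℂ)` given by complex conjugation. -/
noncomputable def conjPoint (x : Points A) : Points A := Complex.conjAe.toAlgHom.comp x

/-- The category of admissible variations of mixed `ℚ`-Hodge structure over `ℝ` on `X = Spec A`, for
a finite étale `ℝ`-algebra `A` such as `ℝ ⊗ F` for a number field `F`.
Here `X` is proper and zero-dimensional, and `X(ℂ)` is a finite discrete space, so that a locally
constant sheaf on `X(ℂ)` is the family of its stalks, a holomorphic subbundle is a family of
subspaces, and Griffith transversality and admissibility are no condition: a variation `𝕍` on `X(ℂ)`
is a family of mixed Hodge structures indexed by `X(ℂ)`.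
The variation `ι^*𝕍` has at `x` the `ℚ`-vector space and the weight filtration of `𝕍` at `ι x`,
and the complex conjugate of the Hodge filtration of `𝕍` at `ι x`; a variation over `ℝ` is a
variation with a morphism `F_∞ : 𝕍 ⟶ ι^*𝕍` such that `F_∞⁻¹ = ι^* F_∞`. -/
structure Var where
  fib : Points A → MHS
  /-- `F_∞` at `x`, with values in the stalk at `y = ι x`. -/
  Finf : ∀ {x y : Points A}, y = conjPoint x → (fib x).V →ₗ[ℚ] (fib y).V
  Finf_W : ∀ {x y : Points A} (h : y = conjPoint x) (n : ℤ) (v : (fib x).V),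
    v ∈ (fib x).W n → Finf h v ∈ (fib y).W n
  Finf_F : ∀ {x y : Points A} (h : y = conjPoint x) (p : ℤ) (v : ℂ ⊗[ℚ] (fib x).V),
    v ∈ (fib x).F p → (Finf h).baseChange ℂ v ∈ conjSub ((fib y).F p)
  Finf_Finf : ∀ {x y : Points A} (h : y = conjPoint x) (h' : x = conjPoint y) (v : (fib x).V),
    Finf h' (Finf h v) = v

namespace Var

variable {A}

/-- Morphisms of variations over `ℝ`: morphisms of mixed Hodge structures at all points that are
compatible with `F_∞`.  They form a `ℚ`-vector space. -/
def Mor (M N : Var A) : Submodule ℚ (∀ x, (M.fib x).V →ₗ[ℚ] (N.fib x).V) where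
  carrier := {f | (∀ x, MHS.IsMor (M.fib x) (N.fib x) (f x)) ∧
    ∀ {x y} (h : y = conjPoint x) (v : (M.fib x).V), f y (M.Finf h v) = N.Finf h (f x v)}
  zero_mem' := ⟨fun x => ⟨fun n v _ => zero_mem _, fun p v _ => by simp⟩, fun h v => by simp⟩
  add_mem' {f g} hf hg := ⟨fun x =>
    ⟨fun n v hv => add_mem ((hf.1 x).map_W n v hv) ((hg.1 x).map_W n v hv), fun p v hv => by
      rw [Pi.add_apply, LinearMap.baseChange_add]
      exact add_mem ((hf.1 x).map_F p v hv) ((hg.1 x).map_F p v hv)⟩,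
    fun h v => by simp [hf.2, hg.2]⟩
  smul_mem' c f hf := ⟨fun x =>
    ⟨fun n v hv => Submodule.smul_mem _ c ((hf.1 x).map_W n v hv), fun p v hv => by
      rw [Pi.smul_apply, LinearMap.baseChange_smul, LinearMap.smul_apply, ← algebraMap_smul ℂ c]
      exact Submodule.smul_mem _ _ ((hf.1 x).map_F p v hv)⟩,
    fun h v => by simp [hf.2]⟩

instance : Category.{u} (Var A) where
  Hom M N := Mor M N
  id M := ⟨fun _ => LinearMap.id, fun _ => ⟨fun _ _ h => h, fun _ _ h => by simpa using h⟩,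
    fun _ _ => rfl⟩
  comp f g := ⟨fun x => g.1 x ∘ₗ f.1 x, fun x => ⟨fun n v hv =>
    (g.2.1 x).map_W n _ ((f.2.1 x).map_W n v hv), fun p v hv => by
      rw [LinearMap.baseChange_comp]
      exact (g.2.1 x).map_F p _ ((f.2.1 x).map_F p v hv)⟩,
    fun h v => by simp [f.2.2, g.2.2]⟩

/-- The map on stalks at `x` of the underlying `ℚ`-vector spaces. -/
def app {M N : Var A} (f : M ⟶ N) (x : Points A) : (M.fib x).V →ₗ[ℚ] (N.fib x).V :=
  Subtype.val (p := (· ∈ Mor M N)) f x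

/-- The complexification of the map on stalks at `x`. -/
noncomputable def appC {M N : Var A} (f : M ⟶ N) (x : Points A) :
    ℂ ⊗[ℚ] (M.fib x).V →ₗ[ℂ] ℂ ⊗[ℚ] (N.fib x).V :=
  (app f x).baseChange ℂ

section

variable {M N P : Var A}

/-- The morphism with given maps on stalks. -/
def mk' (f : ∀ x, (M.fib x).V →ₗ[ℚ] (N.fib x).V)
    (hf : ∀ x, MHS.IsMor (M.fib x) (N.fib x) (f x))
    (hF : ∀ {x y} (h : y = conjPoint x) (v : (M.fib x).V), f y (M.Finf h v) = N.Finf h (f x v)) :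
    M ⟶ N :=
  (⟨f, hf, hF⟩ : Mor M N)

@[simp]
theorem app_mk' (f : ∀ x, (M.fib x).V →ₗ[ℚ] (N.fib x).V) (hf) (hF) (x : Points A) :
    app (mk' (M := M) (N := N) f hf hF) x = f x := rfl

theorem app_isMor (f : M ⟶ N) (x : Points A) : MHS.IsMor (M.fib x) (N.fib x) (app f x) :=
  (Subtype.prop (p := (· ∈ Mor M N)) f).1 x

theorem app_Finf (f : M ⟶ N) {x y : Points A} (h : y = conjPoint x) (v : (M.fib x).V) :
    app f y (M.Finf h v) = N.Finf h (app f x v) :=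
  (Subtype.prop (p := (· ∈ Mor M N)) f).2 h v

theorem hom_ext {f g : M ⟶ N} (h : ∀ x v, app f x v = app g x v) : f = g :=
  Subtype.ext (p := (· ∈ Mor M N)) (funext fun x => LinearMap.ext (h x))

@[simp]
theorem app_comp (f : M ⟶ N) (g : N ⟶ P) (x : Points A) (v : (M.fib x).V) :
    app (f ≫ g) x v = app g x (app f x v) := rfl

@[simp]
theorem app_id (x : Points A) (v : (M.fib x).V) : app (𝟙 M) x v = v := rfl

instance : Preadditive (Var A) where
  homGroup M N := inferInstanceAs (AddCommGroup (Mor M N))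
  add_comp M N P f f' g := hom_ext fun x v => map_add (app g x) (app f x v) (app f' x v)
  comp_add _ _ _ _ _ _ := rfl

instance : Linear ℚ (Var A) where
  homModule M N := inferInstanceAs (Module ℚ (Mor M N))
  smul_comp M N P c f g := hom_ext fun x v => map_smul (app g x) c (app f x v)
  comp_smul _ _ _ _ _ _ := rfl

@[simp]
theorem app_zero (x : Points A) (v : (M.fib x).V) : app (0 : M ⟶ N) x v = 0 := rfl

@[simp]
theorem app_add (f g : M ⟶ N) (x : Points A) (v : (M.fib x).V) :
    app (f + g) x v = app f x v + app g x v := rfl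

/-- `F_∞` on the kernel of a morphism. -/
def kerFinf (f : M ⟶ N) {x y : Points A} (h : y = conjPoint x) :
    LinearMap.ker (app f x) →ₗ[ℚ] LinearMap.ker (app f y) :=
  (M.Finf h).restrict fun v hv => by
    rw [LinearMap.mem_ker] at hv ⊢
    rw [app_Finf, hv, map_zero]

/-- The kernel of a morphism. -/
noncomputable def ker (f : M ⟶ N) : Var A where
  fib x := MHS.ker (app f x) (app_isMor f x)
  Finf h := kerFinf f h
  Finf_W h n v hv := M.Finf_W h n _ hv
  Finf_F {x y} h p v hv :=
    conj_comap (f := kerFinf f h) (g := M.Finf h) (i := (LinearMap.ker (app f x)).subtype)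
      (i' := (LinearMap.ker (app f y)).subtype) (P := (M.fib x).F p) (P' := (M.fib y).F p)
      (fun _ => rfl) (M.Finf_F h p) v hv
  Finf_Finf h h' v := Subtype.ext (M.Finf_Finf h h' _)

/-- The inclusion of the kernel. -/
noncomputable def kerι (f : M ⟶ N) : ker f ⟶ M :=
  mk' (fun x => (LinearMap.ker (app f x)).subtype) (fun _ => ⟨fun _ _ h => h, fun _ _ h => h⟩)
    (fun _ _ => rfl)

theorem kerι_comp (f : M ⟶ N) : kerι f ≫ f = 0 := hom_ext fun _ v => v.2

/-- A morphism that lands in a subobject on stalks, where the subobject has the induced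
filtrations, factors. -/
theorem exists_lift {i : M ⟶ N} (hi : ∀ x, Function.Injective (app i x)) (g : P ⟶ N)
    (hg : ∀ x v, app g x v ∈ LinearMap.range (app i x)) : ∃ l : P ⟶ M, l ≫ i = g := by
  let l (x : Points A) : (P.fib x).V →ₗ[ℚ] (M.fib x).V :=
    (LinearEquiv.ofInjective (app i x) (hi x)).symm.toLinearMap ∘ₗ
      (app g x).codRestrict (LinearMap.range (app i x)) (hg x)
  have hl : ∀ x v, app i x (l x v) = app g x v := fun x v => by
    have := LinearEquiv.apply_symm_apply (LinearEquiv.ofInjective (app i x) (hi x))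
      ((app g x).codRestrict (LinearMap.range (app i x)) (hg x) v)
    exact congrArg Subtype.val this
  have hl' : ∀ x, (app i x) ∘ₗ l x = app g x := fun x => LinearMap.ext (hl x)
  refine ⟨mk' l (fun x => ⟨fun n v hv => ?_, fun p v hv => ?_⟩) (fun {x y} h v => ?_),
    hom_ext hl⟩
  · refine ((app_isMor i x).le_comap_of_injective (hi x)).1 n ?_
    rw [Submodule.mem_comap, hl]
    exact (app_isMor g x).map_W n v hv
  · refine ((app_isMor i x).le_comap_of_injective (hi x)).2 p ?_
    rw [Submodule.mem_comap, ← LinearMap.comp_apply, ← LinearMap.baseChange_comp, hl']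
    exact (app_isMor g x).map_F p v hv
  · apply hi y
    rw [hl, app_Finf, app_Finf, hl]

theorem mono_of_injective {i : M ⟶ N} (hi : ∀ x, Function.Injective (app i x)) : Mono i :=
  ⟨fun f g e => hom_ext fun x v => hi x (by rw [← app_comp, ← app_comp, e])⟩

theorem injective_of_mono (i : M ⟶ N) [Mono i] (x : Points A) : Function.Injective (app i x) := by
  rw [injective_iff_map_eq_zero]
  intro v hv
  have h : kerι i = 0 := by rw [← cancel_mono i, kerι_comp, zero_comp]
  have h2 : app (kerι i) x ⟨v, hv⟩ = 0 := by rw [h]; rfl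
  exact h2

theorem kerι_injective (f : M ⟶ N) (x : Points A) : Function.Injective (app (kerι f) x) :=
  Subtype.val_injective

/-- A morphism that is injective on stalks with image the kernel of `f` is a kernel of `f`. -/
noncomputable def isKernel {i : M ⟶ N} (hi : ∀ x, Function.Injective (app i x)) (f : N ⟶ P)
    (w : i ≫ f = 0) (h : ∀ x, LinearMap.ker (app f x) ≤ LinearMap.range (app i x)) :
    IsLimit (KernelFork.ofι i w) :=
  have := mono_of_injective hi
  KernelFork.IsLimit.ofι' i w fun {T} k hk =>
    have hex := exists_lift hi k fun x v => h x (by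
      rw [LinearMap.mem_ker, ← app_comp, hk, app_zero])
    ⟨hex.choose, hex.choose_spec⟩

instance : HasKernels (Var A) where
  has_limit f := ⟨⟨⟨_, isKernel (kerι_injective f) f (kerι_comp f) fun x =>
    (Submodule.range_subtype _).ge⟩⟩⟩

/-- `F_∞` on the cokernel of a morphism. -/
def cokerFinf (f : M ⟶ N) {x y : Points A} (h : y = conjPoint x) :
    ((N.fib x).V ⧸ LinearMap.range (app f x)) →ₗ[ℚ] ((N.fib y).V ⧸ LinearMap.range (app f y)) :=
  Submodule.mapQ _ _ (N.Finf h) (by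
    rintro _ ⟨v, rfl⟩
    exact ⟨M.Finf h v, app_Finf f h v⟩)

/-- The cokernel of a morphism. -/
noncomputable def coker (f : M ⟶ N) : Var A where
  fib x := MHS.coker (app f x) (app_isMor f x)
  Finf h := cokerFinf f h
  Finf_W h n v hv := by
    obtain ⟨w, hw, rfl⟩ := hv
    exact ⟨_, N.Finf_W h n w hw, rfl⟩
  Finf_F {x y} h p v hv :=
    conj_map (f := N.Finf h) (g := cokerFinf f h) (i := (LinearMap.range (app f x)).mkQ)
      (i' := (LinearMap.range (app f y)).mkQ) (P := (N.fib x).F p) (P' := (N.fib y).F p)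
      (fun _ => rfl) (N.Finf_F h p) v hv
  Finf_Finf h h' v := by
    obtain ⟨w, rfl⟩ := Submodule.mkQ_surjective _ v
    exact congrArg (Submodule.mkQ _) (N.Finf_Finf h h' w)

/-- The projection to the cokernel. -/
noncomputable def cokerπ (f : M ⟶ N) : N ⟶ coker f :=
  mk' (fun x => (LinearMap.range (app f x)).mkQ)
    (fun _ => ⟨fun _ v h => ⟨v, h, rfl⟩, fun _ v h => ⟨v, h, rfl⟩⟩) (fun _ _ => rfl)

theorem comp_cokerπ (f : M ⟶ N) : f ≫ cokerπ f = 0 :=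
  hom_ext fun _ v => (Submodule.Quotient.mk_eq_zero _).2 ⟨v, rfl⟩

theorem exists_desc {p : N ⟶ P} (hp : ∀ x, Function.Surjective (app p x)) (g : N ⟶ M)
    (hg : ∀ x, LinearMap.ker (app p x) ≤ LinearMap.ker (app g x)) : ∃ l : P ⟶ M, p ≫ l = g := by
  let l (x : Points A) : (P.fib x).V →ₗ[ℚ] (M.fib x).V :=
    (LinearMap.ker (app p x)).liftQ (app g x) (hg x) ∘ₗ
      ((app p x).quotKerEquivOfSurjective (hp x)).symm.toLinearMap
  have hl : ∀ x v, l x (app p x v) = app g x v := fun x v => by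
    have : ((app p x).quotKerEquivOfSurjective (hp x)).symm (app p x v) =
        Submodule.Quotient.mk v := by
      rw [LinearEquiv.symm_apply_eq]; rfl
    simp [l, this]
  have hl' : ∀ x, l x ∘ₗ (app p x) = app g x := fun x => LinearMap.ext (hl x)
  refine ⟨mk' l (fun x => ⟨fun n v hv => ?_, fun q v hv => ?_⟩) (fun {x y} h v => ?_),
    hom_ext hl⟩
  · obtain ⟨w, hw, rfl⟩ := ((app_isMor p x).le_map_of_surjective (hp x)).1 n hv
    rw [hl]
    exact (app_isMor g x).map_W n w hw
  · obtain ⟨w, hw, rfl⟩ := ((app_isMor p x).le_map_of_surjective (hp x)).2 q hv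
    rw [← LinearMap.comp_apply, ← LinearMap.baseChange_comp, hl']
    exact (app_isMor g x).map_F q w hw
  · obtain ⟨w, rfl⟩ := hp x v
    rw [hl, ← app_Finf, hl, app_Finf]

theorem epi_of_surjective {p : M ⟶ N} (hp : ∀ x, Function.Surjective (app p x)) : Epi p :=
  ⟨fun f g e => hom_ext fun x v => by
    obtain ⟨w, rfl⟩ := hp x v
    rw [← app_comp, ← app_comp, e]⟩

theorem cokerπ_surjective (f : M ⟶ N) (x : Points A) : Function.Surjective (app (cokerπ f) x) :=
  Submodule.mkQ_surjective _

theorem surjective_of_epi (p : M ⟶ N) [Epi p] (x : Points A) : Function.Surjective (app p x) := by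
  intro v
  have h : cokerπ p = 0 := by rw [← cancel_epi p, comp_cokerπ, comp_zero]
  have h2 : app (cokerπ p) x v = 0 := by rw [h]; rfl
  exact (Submodule.Quotient.mk_eq_zero _).1 h2

/-- A morphism that is surjective on stalks with kernel the image of `f` is a cokernel of `f`. -/
noncomputable def isCokernel {p : N ⟶ P} (hp : ∀ x, Function.Surjective (app p x)) (f : M ⟶ N)
    (w : f ≫ p = 0) (h : ∀ x, LinearMap.ker (app p x) ≤ LinearMap.range (app f x)) :
    IsColimit (CokernelCofork.ofπ p w) :=
  have := epi_of_surjective hp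
  CokernelCofork.IsColimit.ofπ' p w fun {T} k hk =>
    have hex := exists_desc hp k fun x v hv => by
      obtain ⟨u, rfl⟩ := h x hv
      rw [LinearMap.mem_ker, ← app_comp, hk, app_zero]
    ⟨hex.choose, hex.choose_spec⟩

instance : HasCokernels (Var A) where
  has_colimit f := ⟨⟨⟨_, isCokernel (cokerπ_surjective f) f (comp_cokerπ f) fun x =>
    (Submodule.ker_mkQ _).le⟩⟩⟩

instance : IsNormalMonoCategory (Var A) where
  normalMonoOfMono i _ := ⟨⟨_, cokerπ i, comp_cokerπ i,
    isKernel (injective_of_mono i) _ _ fun _ => (Submodule.ker_mkQ _).le⟩⟩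

instance : IsNormalEpiCategory (Var A) where
  normalEpiOfEpi p _ := ⟨⟨_, kerι p, kerι_comp p,
    isCokernel (surjective_of_epi p) _ _ fun _ => (Submodule.range_subtype _).ge⟩⟩

/-- The direct sum of two variations. -/
noncomputable def prod (M N : Var A) : Var A where
  fib x := MHS.prod (M.fib x) (N.fib x)
  Finf h := (M.Finf h).prodMap (N.Finf h)
  Finf_W h n v hv := ⟨M.Finf_W h n _ hv.1, N.Finf_W h n _ hv.2⟩
  Finf_F {x y} h p v hv := And.intro
    (conj_comap (f := (M.Finf h).prodMap (N.Finf h)) (g := M.Finf h)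
      (i := LinearMap.fst ℚ (M.fib x).V (N.fib x).V) (i' := LinearMap.fst ℚ (M.fib y).V (N.fib y).V)
      (P := (M.fib x).F p) (P' := (M.fib y).F p) (fun _ => rfl) (M.Finf_F h p) v hv.1)
    (conj_comap (f := (M.Finf h).prodMap (N.Finf h)) (g := N.Finf h)
      (i := LinearMap.snd ℚ (M.fib x).V (N.fib x).V) (i' := LinearMap.snd ℚ (M.fib y).V (N.fib y).V)
      (P := (N.fib x).F p) (P' := (N.fib y).F p) (fun _ => rfl) (N.Finf_F h p) v hv.2)
  Finf_Finf h h' v := Prod.ext (M.Finf_Finf h h' v.1) (N.Finf_Finf h h' v.2)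

/-- The direct sum as a biproduct diagram. -/
noncomputable def bicone (M N : Var A) : BinaryBicone M N where
  pt := Var.prod M N
  fst := mk' (fun x => LinearMap.fst ℚ _ _) (fun x => ⟨fun n v h => h.1, fun n v h => h.1⟩)
    (fun h v => rfl)
  snd := mk' (fun x => LinearMap.snd ℚ _ _) (fun x => ⟨fun n v h => h.2, fun n v h => h.2⟩)
    (fun h v => rfl)
  inl := mk' (fun x => LinearMap.inl ℚ _ _)
    (fun x => ⟨fun n v h => And.intro h (zero_mem ((N.fib x).W n)), fun n v h => inl_mem h⟩)
    (fun h v => Prod.ext rfl (map_zero (N.Finf h)).symm)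
  inr := mk' (fun x => LinearMap.inr ℚ _ _)
    (fun x => ⟨fun n v h => And.intro (zero_mem ((M.fib x).W n)) h, fun n v h => inr_mem h⟩)
    (fun h v => Prod.ext (map_zero (M.Finf h)).symm rfl)
  inl_fst := hom_ext fun _ _ => rfl
  inl_snd := hom_ext fun _ _ => rfl
  inr_fst := hom_ext fun _ _ => rfl
  inr_snd := hom_ext fun _ _ => rfl

instance : HasBinaryBiproducts (Var A) where
  has_binary_biproduct M N := hasBinaryBiproduct_of_total (bicone M N)
    (hom_ext fun x v => by
      obtain ⟨a, b⟩ := (show (M.fib x).V × (N.fib x).V from v)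
      exact Prod.ext (add_zero a) (zero_add b))

instance : HasZeroObject (Var A) where
  zero := ⟨{
    fib _ := MHS.ofType PUnit 0
    Finf _ := 0
    Finf_W _ _ _ _ := zero_mem _
    Finf_F _ _ _ _ := by simp
    Finf_Finf _ _ _ := rfl }, by
    rw [IsZero.iff_id_eq_zero]
    exact hom_ext fun _ _ => rfl⟩

instance : HasFiniteProducts (Var A) :=
  have : HasTerminal (Var A) := HasZeroObject.hasTerminal
  hasFiniteProducts_of_has_binary_and_terminal

/-- Variations over `ℝ` on `Spec A` form an abelian category. -/
noncomputable instance : Abelian (Var A) where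

/-- The groups `Ext^n` in the category of variations are defined. -/
instance : HasExt.{max 1 u} (Var A) := HasExt.standard (Var A)

end

end Var

/-- The `ℚ`-line `(2πi)^j ℚ ⊂ ℂ`. -/
noncomputable def tateLine (j : ℤ) : Submodule ℚ ℂ :=
  Submodule.span ℚ {(2 * Real.pi * Complex.I : ℂ) ^ j}

/-- Complex conjugation of `ℂ` as a `ℚ`-linear map. -/
noncomputable def conjQ : ℂ →ₗ[ℚ] ℂ := Complex.conjAe.toLinearMap.restrictScalars ℚ

theorem conjQ_mem (j : ℤ) : ∀ z ∈ tateLine j, conjQ z ∈ tateLine j := by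
  intro z hz
  obtain ⟨q, rfl⟩ := Submodule.mem_span_singleton.1 hz
  rw [map_smul]
  refine Submodule.smul_mem _ q ?_
  have : conjQ ((2 * Real.pi * Complex.I : ℂ) ^ j) =
      ((-1 : ℚ) ^ j) • (2 * Real.pi * Complex.I : ℂ) ^ j := by
    have h1 : conjQ ((2 * Real.pi * Complex.I : ℂ) ^ j) =
        starRingEnd ℂ ((2 * Real.pi * Complex.I : ℂ) ^ j) := rfl
    have h2 : (2 * (Real.pi : ℂ) * -Complex.I) = (-1) * (2 * Real.pi * Complex.I) := by ring
    rw [h1, map_zpow₀, map_mul, map_mul, Complex.conj_I, Complex.conj_ofReal, map_ofNat, h2,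
      mul_zpow, Rat.smul_def]
    push_cast
    rfl
  rw [this]
  exact Submodule.smul_mem _ _ (Submodule.mem_span_singleton_self _)

instance (j : ℤ) : Module.Finite ℚ (tateLine j) := by
  unfold tateLine; infer_instance

/-- The Tate variation `ℚ(j)` over `ℝ`: at each point its rational space is `(2πi)^j ℚ ⊂ ℂ`, it is
of type `(-j, -j)`, and `F_∞` is complex conjugation on `(2πi)^j ℚ`. -/
noncomputable def tate (j : ℤ) : Var A where
  fib _ := MHS.ofType (tateLine j) (-j)
  Finf _ := conjQ.restrict (conjQ_mem j)
  Finf_W _ n v hv := map_ite (conjQ.restrict (conjQ_mem j)) _ v hv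
  Finf_F _ p v hv := conj_ite (conjQ.restrict (conjQ_mem j)) _ v hv
  Finf_Finf _ _ v := Subtype.ext (Complex.conj_conj _)

/-- The inclusion of the rational space of `ℚ(j)` at `x` in `ℂ`. -/
noncomputable def tateVal (j : ℤ) (x : Points A) : ((tate A j).fib x).V →ₗ[ℚ] ℂ :=
  (tateLine j).subtype

/-- The canonical isomorphism `ℚ(j)_ℂ = ℂ ⊗ (2πi)^j ℚ ⟶ ℂ` at `x`, `z ⊗ w ↦ z w`. -/
noncomputable def tateValC (j : ℤ) (x : Points A) : ℂ ⊗[ℚ] ((tate A j).fib x).V →ₗ[ℂ] ℂ :=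
  (tateVal A j x).liftBaseChange ℂ

end Variations

/-- Complex conjugation on `ℂ / (2πi)^j ℚ`. -/
noncomputable def conjQuot (j : ℤ) : (ℂ ⧸ tateLine j) →ₗ[ℚ] (ℂ ⧸ tateLine j) :=
  (tateLine j).mapQ (tateLine j) conjQ (conjQ_mem j)

section NumberField

variable (F : Type u) [Field F] [NumberField F]

/-- `(⨁_{σ : F → ℂ} ℂ / (2πi)^j ℚ)^+`: the elements `s` of the (finite) direct sum that are fixed by
the joint operation of complex conjugation, i.e. `s σ` is the conjugate of `s σ̄`. -/
noncomputable def plusPart (j : ℤ) : Submodule ℚ ((F →+* ℂ) → ℂ ⧸ tateLine j) where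
  carrier := {s | ∀ σ, conjQuot j (s (NumberField.ComplexEmbedding.conjugate σ)) = s σ}
  zero_mem' σ := by simp
  add_mem' hs ht σ := by simp [hs σ, ht σ]
  smul_mem' c s hs σ := by simp [hs σ]

variable {F}

/-- The embedding `F → ℂ` that corresponds to a complex point of `Spec (ℝ ⊗ F)`. -/
noncomputable def embeddingOf (x : Points (ℝ ⊗[ℚ] F)) : F →+* ℂ :=
  (x : ℝ ⊗[ℚ] F →+* ℂ).comp
    (Algebra.TensorProduct.includeRight : F →ₐ[ℚ] ℝ ⊗[ℚ] F).toRingHom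

end NumberField

end Hodge

/-! ### First extension groups and short exact sequences in an abelian category. -/

section ExtOne

open Abelian Pretriangulated

variable {C : Type*} [Category* C] [Abelian C]

/-! Let `M` be a variation with weights `≤ -1` and `F⁰ = 0`, such as `ℚ(j)` for `j ≥ 1`. An
extension of `ℚ(0)` by `M` is, as a rational filtered space with `F_∞`, just `M ⊕ ℚ(0)`; all its
content is the position of the Hodge lift of `1` relative to a rational lift. The difference `a =
e_F - e_ℚ` is a family of elements of `M_ℂ`, and for an `F_∞`-invariant `e_ℚ` it is fixed by the
semilinear involution `conjDR` (`F_∞` followed by complex conjugation). Conversely, an invariant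
family `a` yields the extension `ext`, whose Hodge filtration is the direct sum filtration moved by
`1 + N`, with `N` sending `1 ∈ ℚ(0)` to `a`. Since `N` lowers weights, the graded pieces do not
change, so this is again a mixed Hodge structure.

This gives a map from invariant families to `Ext¹(ℚ(0), M)`. It is additive because it is functorial
in `M` (`invariantsClass_comp_mk₀`), which replaces a computation of Baer sums. It is surjective
(`exists_lifts`): every class comes from a short exact sequence, rational lifts can be averaged over
`F_∞`, and Hodge lifts exist by strictness and are unique because `F⁰M = 0`. Its kernel consists of
the families of rational elements (`invariantsClass_eq_zero_iff`), since a splitting sends `1` to an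
element that is both rational and in `F⁰`.

For `M = ℚ(j)` the invariant families are the conjugation-equivariant families of complex numbers.
They also surject onto `(⨁ ℂ/(2πi)^j ℚ)⁺`, again by averaging, and the kernel is the same: the
families with values in `(2πi)^j ℚ`. Identifying the two quotients gives the isomorphism. Other
lifts change `e_F - e_ℚ` only by a rational element, which gives the stated formula; since every
class is that of an extension with such lifts, the formula determines the isomorphism. -/

theorem DerivedCategory.hom_singleFunctor_shift_eq_zero [HasDerivedCategory C] ⦃X Y : C⦄ ⦃n : ℤ⦄
    (f : (singleFunctor C 0).obj X ⟶ ((singleFunctor C 0).obj Y)⟦n⟧) (hn : n < 0) : f = 0 := by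
  -- `Y⟦n⟧` sits in degree `-n > 0` and `X` in degree `0`, so the t-structure forbids nonzero maps.
  have := TStructure.t.isGE_shift ((singleFunctor C 0).obj Y) 0 n (-n)
  exact TStructure.t.zero f 0 (-n)

/-- A distinguished triangle in the derived category whose outer terms are concentrated in degree
zero comes from a short exact sequence. -/
theorem DerivedCategory.exists_shortExact_singleδ_eq [HasDerivedCategory C] {X Z : C}
    (e : (singleFunctor C 0).obj Z ⟶ ((singleFunctor C 0).obj X)⟦(1 : ℤ)⟧) :
    ∃ (E : C) (i : X ⟶ E) (p : E ⟶ Z) (w : i ≫ p = 0) (hS : (ShortComplex.mk i p w).ShortExact),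
      hS.singleδ = e := by
  obtain ⟨K, f, g, hT⟩ := distinguished_cocone_triangle₂ e
  -- The middle term `K` of the triangle lies in the heart because the heart is closed under
  -- extensions.
  have : K.IsLE 0 := TStructure.t.isLE₂ _ hT 0
    (inferInstanceAs (((singleFunctor C 0).obj X).IsLE 0))
    (inferInstanceAs (((singleFunctor C 0).obj Z).IsLE 0))
  have : K.IsGE 0 := TStructure.t.isGE₂ _ hT 0
    (inferInstanceAs (((singleFunctor C 0).obj X).IsGE 0))
    (inferInstanceAs (((singleFunctor C 0).obj Z).IsGE 0))
  obtain ⟨E, ⟨a⟩⟩ := exists_iso_singleFunctor_obj_of_isGE_of_isLE K 0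
  obtain ⟨i, hi⟩ := (singleFunctor C 0).map_surjective (f ≫ a.hom)
  obtain ⟨p, hp⟩ := (singleFunctor C 0).map_surjective (a.inv ≫ g)
  have hT' : Triangle.mk ((singleFunctor C 0).map i) ((singleFunctor C 0).map p) e ∈
      distTriang (DerivedCategory C) :=
    isomorphic_distinguished _ hT _ (Triangle.isoMk _ _ (Iso.refl _) a.symm (Iso.refl _)
      (show (singleFunctor C 0).map i ≫ a.inv = 𝟙 _ ≫ f by simp [hi])
      (show (singleFunctor C 0).map p ≫ 𝟙 _ = a.inv ≫ g by simp [hp])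
      (show e ≫ (𝟙 _)⟦(1 : ℤ)⟧' = 𝟙 _ ≫ e by simp))
  have w : i ≫ p = 0 := (singleFunctor C 0).map_injective (by
    rw [Functor.map_comp, Functor.map_zero]
    exact comp_distTriang_mor_zero₁₂ _ hT')
  -- A triangle with vertices in the heart is a kernel-cokernel pair once the negative Homs vanish.
  have hk := Triangulated.AbelianSubcategory.isLimitKernelForkOfDistTriang
    hom_singleFunctor_shift_eq_zero i p e hT'
  have hc := Triangulated.AbelianSubcategory.isColimitCokernelCoforkOfDistTriang
    hom_singleFunctor_shift_eq_zero i p e hT'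
  have : Mono i := mono_of_isLimit_fork hk
  have : Epi p := epi_of_isColimit_cofork hc
  have hS : (ShortComplex.mk i p w).ShortExact :=
    { exact := ShortComplex.exact_of_f_is_kernel _ hk }
  refine ⟨E, i, p, w, hS, ?_⟩
  -- The two triangles share their first two morphisms but possibly not the third. The comparison
  -- map `c` on `Z` satisfies `p ≫ c = p`, so `c = 𝟙` as `p` is epi, and the connecting maps agree.
  obtain ⟨c, h2, h3⟩ := complete_distinguished_triangle_morphism _ _
    hS.singleTriangle_distinguished hT' (𝟙 _) (𝟙 _) ((Category.comp_id _).trans (Category.id_comp _).symm)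
  obtain ⟨c, rfl⟩ := (singleFunctor C 0).map_surjective c
  have hc : c = 𝟙 Z := by
    rw [← cancel_epi p, Category.comp_id]
    apply (singleFunctor C 0).map_injective
    rw [Functor.map_comp]
    exact h2.trans (Category.id_comp _)
  have h4 : hS.singleδ ≫ (𝟙 _)⟦(1 : ℤ)⟧' = (singleFunctor C 0).map c ≫ e := h3
  rwa [hc, CategoryTheory.Functor.map_id, CategoryTheory.Functor.map_id, Category.comp_id,
    Category.id_comp] at h4

/-- Every element of `Ext¹` is the class of a short exact sequence. -/
theorem CategoryTheory.Abelian.Ext.exists_extClass_eq [HasExt C] {X Z : C} (e : Ext Z X 1) :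
    ∃ (E : C) (i : X ⟶ E) (p : E ⟶ Z) (w : i ≫ p = 0) (hS : (ShortComplex.mk i p w).ShortExact),
      hS.extClass = e := by
  let := HasDerivedCategory.standard C
  obtain ⟨E, i, p, w, hS, h⟩ := DerivedCategory.exists_shortExact_singleδ_eq e.hom
  exact ⟨E, i, p, w, hS, Ext.ext (by rw [hS.extClass_hom]; exact h)⟩

/-- A short exact sequence whose class vanishes splits. -/
theorem CategoryTheory.ShortComplex.ShortExact.exists_section_of_extClass_eq_zero [HasExt C]
    {S : ShortComplex C} (hS : S.ShortExact) (h : hS.extClass = 0) :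
    ∃ s : S.X₃ ⟶ S.X₂, s ≫ S.g = 𝟙 _ := by
  -- The connecting map of the long exact sequence sends the identity of `S.X₃` to the class of `S`;
  -- if that is zero, the identity lifts to `S.X₂`.
  obtain ⟨x, hx⟩ := Ext.covariant_sequence_exact₃ S.X₃ hS (Ext.mk₀ (𝟙 S.X₃)) (zero_add 1)
    (by rw [h, Ext.comp_zero])
  obtain ⟨s, rfl⟩ := (Ext.mk₀_bijective _ _).2 x
  exact ⟨s, (Ext.mk₀_bijective _ _).1 (by rwa [← Ext.mk₀_comp_mk₀])⟩

/-- The class of a split short exact sequence vanishes. -/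
theorem CategoryTheory.ShortComplex.ShortExact.extClass_eq_zero_of_retraction [HasExt C]
    {S : ShortComplex C} (hS : S.ShortExact) (r : S.X₂ ⟶ S.X₁) (h : S.f ≫ r = 𝟙 _) :
    hS.extClass = 0 := by
  -- The class composed with `S.f` is zero, and composing further with `r` gives back the class.
  rw [← Ext.comp_mk₀_id hS.extClass, ← h, ← Ext.mk₀_comp_mk₀, hS.extClass_comp_assoc]

end ExtOne

namespace Hodge

/-! ### Unipotent translation of the Hodge filtration. -/

section Twist

variable {k V : Type*} [Field k] [AddCommGroup V] [Module k V]

/-- The image of `P` under `1 + N`, when `N ^ 2 = 0`. -/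
def unipotentTwist (N : V →ₗ[k] V) (P : Submodule k V) : Submodule k V :=
  P.comap (LinearMap.id - N)

variable {N : V →ₗ[k] V} {P : Submodule k V}

theorem mem_unipotentTwist {v : V} : v ∈ unipotentTwist N P ↔ v - N v ∈ P := Iff.rfl

/-- On `W₁` the maps `1 ± N` are the identity modulo `W₀`, so moving `P` by them does not change its
image in `W₁ / W₀`. -/
theorem unipotentTwist_inf_sup (hN : ∀ v, N (N v) = 0) {W₁ W₀ : Submodule k V}
    (hW : ∀ v ∈ W₁, N v ∈ W₀) (hle : W₀ ≤ W₁) :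
    unipotentTwist N P ⊓ W₁ ⊔ W₀ = P ⊓ W₁ ⊔ W₀ := by
  apply le_antisymm
  · refine sup_le (fun v hv => ?_) le_sup_right
    rw [← sub_add_cancel v (N v)]
    exact add_mem (Submodule.mem_sup_left ⟨hv.1, sub_mem hv.2 (hle (hW v hv.2))⟩)
      (Submodule.mem_sup_right (hW v hv.2))
  · refine sup_le (fun v hv => ?_) le_sup_right
    rw [← add_sub_cancel_right v (N v)]
    refine sub_mem (Submodule.mem_sup_left ⟨?_, add_mem hv.2 (hle (hW v hv.2))⟩)
      (Submodule.mem_sup_right (hW v hv.2))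
    rw [SetLike.mem_coe, mem_unipotentTwist, map_add, hN, add_zero, add_sub_cancel_right]
    exact hv.1

theorem unipotentTwist_bot (hN : ∀ v, N (N v) = 0) : unipotentTwist N ⊥ = ⊥ := by
  rw [eq_bot_iff]
  intro v hv
  rw [mem_unipotentTwist, Submodule.mem_bot, sub_eq_zero] at hv
  rw [Submodule.mem_bot, hv, hv, hN]

/-- Opposedness only concerns the filtrations induced on the graded pieces of `W`, where both
translations are invisible. -/
theorem Opposed.unipotentTwist {W F G : ℤ → Submodule k V} (h : Opposed W F G) (hW : Monotone W)
    {N N' : V →ₗ[k] V} (hN : ∀ v, N (N v) = 0) (hN' : ∀ v, N' (N' v) = 0)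
    (hNW : ∀ n, ∀ v ∈ W n, N v ∈ W (n - 1)) (hNW' : ∀ n, ∀ v ∈ W n, N' v ∈ W (n - 1)) :
    Opposed W (fun p => Hodge.unipotentTwist N (F p)) (fun q => Hodge.unipotentTwist N' (G q)) := by
  intro n p q e
  have hle : W (n - 1) ≤ W n := hW (by omega)
  rw [unipotentTwist_inf_sup hN (hNW n) hle, unipotentTwist_inf_sup hN' (hNW' n) hle]
  exact h n p q e

end Twist

section Conj

variable {V : Type*} [AddCommGroup V] [Module ℚ V]

theorem conjC_mem_baseChange {P : Submodule ℚ V} {x : ℂ ⊗[ℚ] V} (hx : x ∈ P.baseChange ℂ) :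
    conjC V x ∈ P.baseChange ℂ := by
  obtain ⟨y, rfl⟩ := hx
  rw [conjC_baseChange]
  exact ⟨_, rfl⟩

/-- The complex conjugate of an endomorphism of `V_ℂ`. -/
noncomputable def conjEnd (N : ℂ ⊗[ℚ] V →ₗ[ℂ] ℂ ⊗[ℚ] V) : ℂ ⊗[ℚ] V →ₗ[ℂ] ℂ ⊗[ℚ] V :=
  ((conjC V).comp N).comp (conjC V)

@[simp]
theorem conjEnd_apply (N : ℂ ⊗[ℚ] V →ₗ[ℂ] ℂ ⊗[ℚ] V) (x : ℂ ⊗[ℚ] V) :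
    conjEnd N x = conjC V (N (conjC V x)) := rfl

/-- The conjugate of a translated filtration is a translated filtration too, though by a different
endomorphism; hence two endomorphisms `N` and `N'` in `Opposed.unipotentTwist`. -/
theorem conjSub_unipotentTwist (N : ℂ ⊗[ℚ] V →ₗ[ℂ] ℂ ⊗[ℚ] V) (P : Submodule ℂ (ℂ ⊗[ℚ] V)) :
    conjSub (unipotentTwist N P) = unipotentTwist (conjEnd N) (conjSub P) := by
  ext x
  simp [mem_conjSub, mem_unipotentTwist]

end Conj

/-- The mixed Hodge structure whose Hodge filtration is translated by `1 + N`, where `N` has square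
zero and lowers the weights. -/
noncomputable def MHS.twist (M : MHS) (N : ℂ ⊗[ℚ] M.V →ₗ[ℂ] ℂ ⊗[ℚ] M.V) (hN : ∀ v, N (N v) = 0)
    (hW : ∀ n, ∀ v ∈ (M.W n).baseChange ℂ, N v ∈ (M.W (n - 1)).baseChange ℂ) : MHS where
  V := M.V
  W := M.W
  W_mono := M.W_mono
  W_bot := M.W_bot
  W_top := M.W_top
  F p := unipotentTwist N (M.F p)
  F_anti _ _ e := Submodule.comap_mono (M.F_anti e)
  F_bot := M.F_bot.imp fun p e => by rw [e, unipotentTwist_bot hN]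
  F_top := M.F_top.imp fun p e => by rw [e]; rfl
  opposed := by
    simp only [conjSub_unipotentTwist]
    -- The conjugate of `N` lowers weights as well, because the weight filtration is rational and so
    -- stable under conjugation.
    refine M.opposed.unipotentTwist M.isTriple.W_mono hN (fun v => ?_) hW
      fun n v hv => conjC_mem_baseChange (hW n _ (conjC_mem_baseChange hv))
    simp [hN]

/-! ### The de Rham involution, its invariants, and exactness on stalks. -/

namespace Var

variable {A : Type u} [CommRing A] [Algebra ℝ A] {M N P : Var A}

/-- The semilinear involution of the complexification of a variation induced by `F_∞` and complex
conjugation; it preserves the Hodge filtration. -/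
noncomputable def conjDR (M : Var A) {x y : Points A} (h : y = conjPoint x) :
    ℂ ⊗[ℚ] (M.fib x).V →ₛₗ[starRingEnd ℂ] ℂ ⊗[ℚ] (M.fib y).V :=
  (conjC _).comp ((M.Finf h).baseChange ℂ)

@[simp]
theorem conjDR_tmul {x y : Points A} (h : y = conjPoint x) (z : ℂ) (v : (M.fib x).V) :
    M.conjDR h (z ⊗ₜ v) = starRingEnd ℂ z ⊗ₜ M.Finf h v := rfl

theorem conjDR_mem_F {x y : Points A} (h : y = conjPoint x) {p : ℤ} {v : ℂ ⊗[ℚ] (M.fib x).V}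
    (hv : v ∈ (M.fib x).F p) : M.conjDR h v ∈ (M.fib y).F p :=
  M.Finf_F h p v hv

@[simp]
theorem appC_tmul (f : M ⟶ N) (x : Points A) (z : ℂ) (v : (M.fib x).V) :
    appC f x (z ⊗ₜ v) = z ⊗ₜ app f x v := rfl

theorem appC_conjDR (f : M ⟶ N) {x y : Points A} (h : y = conjPoint x) (v : ℂ ⊗[ℚ] (M.fib x).V) :
    appC f y (M.conjDR h v) = N.conjDR h (appC f x v) := by
  induction v with
  | zero => simp only [map_zero]
  | add a b ha hb => simp only [map_add, ha, hb]
  | tmul z v => rw [conjDR_tmul, appC_tmul, appC_tmul, conjDR_tmul, app_Finf]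

theorem appC_mem_F (f : M ⟶ N) (x : Points A) {p : ℤ} {v : ℂ ⊗[ℚ] (M.fib x).V}
    (hv : v ∈ (M.fib x).F p) : appC f x v ∈ (N.fib x).F p :=
  (app_isMor f x).map_F p v hv

theorem appC_comp (f : M ⟶ N) (g : N ⟶ P) (x : Points A) (v : ℂ ⊗[ℚ] (M.fib x).V) :
    appC (f ≫ g) x v = appC g x (appC f x v) := by
  induction v with
  | zero => simp only [map_zero]
  | add a b ha hb => simp only [map_add, ha, hb]
  | tmul z v => simp only [appC_tmul, app_comp]

theorem appC_add (f g : M ⟶ N) (x : Points A) (v : ℂ ⊗[ℚ] (M.fib x).V) :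
    appC (f + g) x v = appC f x v + appC g x v := by
  induction v with
  | zero => simp only [map_zero, add_zero]
  | add a b ha hb => simp only [map_add, ha, hb]; abel
  | tmul z v => simp only [appC_tmul, app_add, TensorProduct.tmul_add]

@[simp]
theorem appC_id (x : Points A) (v : ℂ ⊗[ℚ] (M.fib x).V) : appC (𝟙 M) x v = v := by
  induction v with
  | zero => simp only [map_zero]
  | add a b ha hb => simp only [map_add, ha, hb]
  | tmul z v => simp only [appC_tmul, app_id]

@[simp]
theorem appC_zero (x : Points A) (v : ℂ ⊗[ℚ] (M.fib x).V) : appC (0 : M ⟶ N) x v = 0 := by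
  induction v with
  | zero => simp only [map_zero]
  | add a b ha hb => simp only [map_add, ha, hb, add_zero]
  | tmul z v => simp only [appC_tmul, app_zero, TensorProduct.tmul_zero]

/-- The families of elements of the complexified stalks that are invariant under `conjDR`. -/
noncomputable def invariants (M : Var A) : AddSubgroup (∀ x, ℂ ⊗[ℚ] (M.fib x).V) where
  carrier := {a | ∀ {x y} (h : y = conjPoint x), M.conjDR h (a x) = a y}
  zero_mem' h := map_zero _
  add_mem' ha hb _ _ h := by simp [ha h, hb h]
  neg_mem' ha _ _ h := by simp [ha h]

/-- The map on invariants induced by a morphism. -/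
noncomputable def invariantsMap (f : M ⟶ N) : M.invariants →+ N.invariants where
  toFun a := ⟨fun x => appC f x (a.1 x), fun h => by rw [← appC_conjDR, a.2 h]⟩
  map_zero' := Subtype.ext (funext fun x => map_zero (appC f x))
  map_add' a b := Subtype.ext (funext fun x => map_add (appC f x) (a.1 x) (b.1 x))

theorem invariantsMap_comp (f : M ⟶ N) (g : N ⟶ P) (a : M.invariants) :
    invariantsMap (f ≫ g) a = invariantsMap g (invariantsMap f a) :=
  Subtype.ext (funext fun x => appC_comp f g x (a.1 x))

theorem invariantsMap_hom_add (f g : M ⟶ N) (a : M.invariants) :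
    invariantsMap (f + g) a = invariantsMap f a + invariantsMap g a :=
  Subtype.ext (funext fun x => appC_add f g x (a.1 x))

theorem invariantsMap_id (a : M.invariants) : invariantsMap (𝟙 M) a = a :=
  Subtype.ext (funext fun x => appC_id x (a.1 x))

theorem invariantsMap_hom_zero (a : M.invariants) : invariantsMap (0 : M ⟶ N) a = 0 :=
  Subtype.ext (funext fun x => appC_zero x (a.1 x))

/-- The variation whose Hodge filtration is translated by `1 + T`. -/
noncomputable def twist (M : Var A) (T : ∀ x, ℂ ⊗[ℚ] (M.fib x).V →ₗ[ℂ] ℂ ⊗[ℚ] (M.fib x).V)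
    (hT : ∀ x v, T x (T x v) = 0)
    (hW : ∀ x n, ∀ v ∈ ((M.fib x).W n).baseChange ℂ, T x v ∈ ((M.fib x).W (n - 1)).baseChange ℂ)
    (hc : ∀ {x y} (h : y = conjPoint x) v, M.conjDR h (T x v) = T y (M.conjDR h v)) : Var A where
  fib x := (M.fib x).twist (T x) (hT x) (hW x)
  Finf h := M.Finf h
  Finf_W h := M.Finf_W h
  Finf_F {x y} h p v hv := by
    -- In terms of `M` itself, `v - T v ∈ F^p` has to be preserved by `conjDR`; this is the
    -- commutation of `T` with `conjDR`.
    have key : ∀ v : ℂ ⊗[ℚ] (M.fib x).V, v - T x v ∈ (M.fib x).F p →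
        M.conjDR h v - T y (M.conjDR h v) ∈ (M.fib y).F p := fun v hv => by
      rw [← hc, ← map_sub]
      exact M.Finf_F h p _ hv
    exact key v hv
  Finf_Finf h h' := M.Finf_Finf h h'

theorem shortExact_of_app {i : M ⟶ N} {p : N ⟶ P} (w : i ≫ p = 0)
    (hi : ∀ x, Function.Injective (app i x)) (hp : ∀ x, Function.Surjective (app p x))
    (h : ∀ x, LinearMap.ker (app p x) ≤ LinearMap.range (app i x)) :
    (ShortComplex.mk i p w).ShortExact :=
  have := mono_of_injective hi
  have := epi_of_surjective hp
  { exact := ShortComplex.exact_of_f_is_kernel _ (isKernel hi p w h) }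

/-- Abstractly `i` is a kernel of `p`, so the concrete kernel with its inclusion `kerι p` factors
through it. -/
theorem exists_app_eq_of_shortExact {i : M ⟶ N} {p : N ⟶ P} {w : i ≫ p = 0}
    (hS : (ShortComplex.mk i p w).ShortExact) {x : Points A} {v : (N.fib x).V}
    (hv : app p x v = 0) : ∃ m, app i x m = v := by
  let l : ker p ⟶ M := hS.fIsKernel.lift (KernelFork.ofι (kerι p) (kerι_comp p))
  have hl : l ≫ i = kerι p :=
    hS.fIsKernel.fac (KernelFork.ofι (kerι p) (kerι_comp p)) WalkingParallelPair.zero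
  have e : app (l ≫ i) x ⟨v, hv⟩ = v := by rw [hl]; rfl
  exact ⟨app l x ⟨v, hv⟩, e⟩

theorem injective_of_shortExact {i : M ⟶ N} {p : N ⟶ P} {w : i ≫ p = 0}
    (hS : (ShortComplex.mk i p w).ShortExact) (x : Points A) : Function.Injective (app i x) :=
  have : Mono i := hS.mono_f
  injective_of_mono i x

theorem surjective_of_shortExact {i : M ⟶ N} {p : N ⟶ P} {w : i ≫ p = 0}
    (hS : (ShortComplex.mk i p w).ShortExact) (x : Points A) : Function.Surjective (app p x) :=
  have : Epi p := hS.epi_g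
  surjective_of_epi p x

theorem range_appC_of_shortExact {i : M ⟶ N} {p : N ⟶ P} {w : i ≫ p = 0}
    (hS : (ShortComplex.mk i p w).ShortExact) (x : Points A) :
    LinearMap.range (appC i x) = LinearMap.ker (appC p x) := by
  refine ker_baseChange_eq (le_antisymm ?_ fun v hv => exists_app_eq_of_shortExact hS hv)
  rintro _ ⟨m, rfl⟩
  rw [LinearMap.mem_ker, ← app_comp, w, app_zero]

theorem appC_injective {i : M ⟶ N} {x : Points A} (hi : Function.Injective (app i x)) :
    Function.Injective (appC i x) :=
  Module.Flat.lTensor_preserves_injective_linearMap (M := ℂ) _ hi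

end Var

/-! ### Coordinates on the Tate variations. -/

section Tate

theorem two_pi_I_zpow_ne_zero (j : ℤ) : (2 * Real.pi * Complex.I : ℂ) ^ j ≠ 0 :=
  zpow_ne_zero _ Complex.two_pi_I_ne_zero

variable {A : Type u} [CommRing A] [Algebra ℝ A]

/-- The coordinate on the rational space of `ℚ(j)` with respect to the generator `(2πi)^j`. -/
noncomputable def tateCoord (j : ℤ) (x : Points A) : ((tate A j).fib x).V ≃ₗ[ℚ] ℚ :=
  (LinearEquiv.toSpanNonzeroSingleton ℚ ℂ _ (two_pi_I_zpow_ne_zero j)).symm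

/-- The generator `(2πi)^j` of the rational space of `ℚ(j)`. -/
noncomputable def tateGen (j : ℤ) (x : Points A) : ((tate A j).fib x).V :=
  (tateCoord j x).symm 1

theorem tateCoord_smul_tateGen (j : ℤ) (x : Points A) (v : ((tate A j).fib x).V) :
    tateCoord j x v • tateGen j x = v := by
  rw [tateGen, ← map_smul, smul_eq_mul, mul_one, LinearEquiv.symm_apply_apply]

theorem tateVal_tateGen (j : ℤ) (x : Points A) :
    tateVal A j x (tateGen j x) = (2 * Real.pi * Complex.I : ℂ) ^ j :=
  congrArg Subtype.val
    (LinearEquiv.toSpanNonzeroSingleton_one ℚ ℂ _ (two_pi_I_zpow_ne_zero j))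

theorem tateVal_mem (j : ℤ) (x : Points A) (v : ((tate A j).fib x).V) :
    tateVal A j x v ∈ tateLine j :=
  Subtype.prop (p := (· ∈ tateLine j)) v

theorem exists_tateVal_eq {j : ℤ} (x : Points A) {z : ℂ} (hz : z ∈ tateLine j) :
    ∃ v, tateVal A j x v = z :=
  ⟨⟨z, hz⟩, rfl⟩

theorem tateVal_injective (j : ℤ) (x : Points A) : Function.Injective (tateVal A j x) :=
  Subtype.val_injective

theorem tateVal_Finf (j : ℤ) {x y : Points A} (h : y = conjPoint x) (v : ((tate A j).fib x).V) :
    tateVal A j y ((tate A j).Finf h v) = starRingEnd ℂ (tateVal A j x v) := rfl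

@[simp]
theorem tateValC_tmul (j : ℤ) (x : Points A) (z : ℂ) (v : ((tate A j).fib x).V) :
    tateValC A j x (z ⊗ₜ v) = z * tateVal A j x v := by
  rw [tateValC, LinearMap.liftBaseChange_tmul, smul_eq_mul]

theorem tateValC_conjDR (j : ℤ) {x y : Points A} (h : y = conjPoint x)
    (v : ℂ ⊗[ℚ] ((tate A j).fib x).V) :
    tateValC A j y ((tate A j).conjDR h v) = starRingEnd ℂ (tateValC A j x v) := by
  induction v with
  | zero => simp only [map_zero]
  | add a b ha hb => simp only [map_add, ha, hb]
  | tmul z v => rw [Var.conjDR_tmul, tateValC_tmul, tateValC_tmul, map_mul, tateVal_Finf]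

/-- The rational space is a line, so a tensor is a complex multiple of the generator, and `tateValC`
reads off the coefficient. Injectivity of `tateValC` follows. -/
theorem eq_tmul_tateGen (j : ℤ) (x : Points A) (v : ℂ ⊗[ℚ] ((tate A j).fib x).V) :
    v = (tateValC A j x v / (2 * Real.pi * Complex.I : ℂ) ^ j) ⊗ₜ tateGen j x := by
  induction v with
  | zero => simp only [map_zero, zero_div, TensorProduct.zero_tmul]
  | add a b ha hb =>
    rw [map_add, add_div, TensorProduct.add_tmul, ← ha, ← hb]
  | tmul z v =>
    rw [tateValC_tmul]
    nth_rw 1 2 [← tateCoord_smul_tateGen j x v]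
    rw [map_smul, tateVal_tateGen, ← TensorProduct.smul_tmul, mul_smul_comm, smul_div_assoc,
      mul_div_cancel_right₀ _ (two_pi_I_zpow_ne_zero j)]

theorem tateValC_injective (j : ℤ) (x : Points A) : Function.Injective (tateValC A j x) :=
  fun v w h => by rw [eq_tmul_tateGen j x v, h, ← eq_tmul_tateGen j x w]

theorem tateValC_surjective (j : ℤ) (x : Points A) : Function.Surjective (tateValC A j x) :=
  fun z => ⟨(z / (2 * Real.pi * Complex.I : ℂ) ^ j) ⊗ₜ tateGen j x, by
    rw [tateValC_tmul, tateVal_tateGen, div_mul_cancel₀ _ (two_pi_I_zpow_ne_zero j)]⟩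

/-- Under `ℚ(j)_ℂ = ℂ` the rational elements are exactly `(2πi)^j ℚ`; this is what matches the
kernels of the two maps out of the invariant families. -/
theorem tateValC_mem_iff {j : ℤ} {x : Points A} {v : ℂ ⊗[ℚ] ((tate A j).fib x).V} :
    tateValC A j x v ∈ tateLine j ↔ ∃ m, v = 1 ⊗ₜ m := by
  constructor
  · intro h
    obtain ⟨m, hm⟩ := exists_tateVal_eq x h
    exact ⟨m, tateValC_injective j x (by rw [tateValC_tmul, one_mul, hm])⟩
  · rintro ⟨m, rfl⟩
    rw [tateValC_tmul, one_mul]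
    exact tateVal_mem j x m

theorem tate_W_of_lt {j n : ℤ} (h : n < -2 * j) (x : Points A) : ((tate A j).fib x).W n = ⊥ :=
  if_neg (by omega)

theorem tate_W_of_le {j n : ℤ} (h : -2 * j ≤ n) (x : Points A) : ((tate A j).fib x).W n = ⊤ :=
  if_pos (by omega)

theorem tate_F_of_lt {j p : ℤ} (h : -j < p) (x : Points A) : ((tate A j).fib x).F p = ⊥ :=
  if_neg (by omega)

theorem tate_F_of_le {j p : ℤ} (h : p ≤ -j) (x : Points A) : ((tate A j).fib x).F p = ⊤ :=
  if_pos (by omega)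

end Tate

/-! ### The extension of `ℚ(0)` by `M` attached to an invariant family. -/

namespace Var

variable {A : Type u} [CommRing A] [Algebra ℝ A] {M N E : Var A}

/-- The inclusion of the first summand. -/
noncomputable def prodInl (M N : Var A) : M ⟶ prod M N := (bicone M N).inl

/-- The inclusion of the second summand. -/
noncomputable def prodInr (M N : Var A) : N ⟶ prod M N := (bicone M N).inr

/-- The projection to the first summand. -/
noncomputable def prodFst (M N : Var A) : prod M N ⟶ M := (bicone M N).fst

/-- The projection to the second summand. -/
noncomputable def prodSnd (M N : Var A) : prod M N ⟶ N := (bicone M N).snd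

theorem prodInl_fst : prodInl M N ≫ prodFst M N = 𝟙 M := (bicone M N).inl_fst

theorem prodInl_snd : prodInl M N ≫ prodSnd M N = 0 := (bicone M N).inl_snd

theorem prodInr_fst : prodInr M N ≫ prodFst M N = 0 := (bicone M N).inr_fst

theorem prodInr_snd : prodInr M N ≫ prodSnd M N = 𝟙 N := (bicone M N).inr_snd

theorem app_prod_total (x : Points A) (v : ((prod M N).fib x).V) :
    app (prodInl M N) x (app (prodFst M N) x v) + app (prodInr M N) x (app (prodSnd M N) x v) =
      v :=
  Prod.ext (add_zero (Prod.fst (α := (M.fib x).V) (β := (N.fib x).V) v))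
    (zero_add (Prod.snd (α := (M.fib x).V) (β := (N.fib x).V) v))

theorem mem_prod_W {x : Points A} {n : ℤ} {v : ((prod M N).fib x).V} :
    v ∈ ((prod M N).fib x).W n ↔
      app (prodFst M N) x v ∈ (M.fib x).W n ∧ app (prodSnd M N) x v ∈ (N.fib x).W n := Iff.rfl

theorem mem_prod_F {x : Points A} {p : ℤ} {v : ℂ ⊗[ℚ] ((prod M N).fib x).V} :
    v ∈ ((prod M N).fib x).F p ↔
      appC (prodFst M N) x v ∈ (M.fib x).F p ∧ appC (prodSnd M N) x v ∈ (N.fib x).F p := Iff.rfl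

section Extension

/-- The nilpotent endomorphism of `(M ⊕ ℚ(0))_ℂ` that maps the generator of `ℚ(0)` to `a`. -/
noncomputable def extEnd (a : ∀ x, ℂ ⊗[ℚ] (M.fib x).V) (x : Points A) :
    ℂ ⊗[ℚ] ((prod M (tate A 0)).fib x).V →ₗ[ℂ] ℂ ⊗[ℚ] ((prod M (tate A 0)).fib x).V :=
  LinearMap.toSpanSingleton ℂ _ (appC (prodInl M (tate A 0)) x (a x)) ∘ₗ
    tateValC A 0 x ∘ₗ appC (prodSnd M (tate A 0)) x

theorem extEnd_apply (a : ∀ x, ℂ ⊗[ℚ] (M.fib x).V) (x : Points A)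
    (v : ℂ ⊗[ℚ] ((prod M (tate A 0)).fib x).V) :
    extEnd a x v = tateValC A 0 x (appC (prodSnd M (tate A 0)) x v) •
      appC (prodInl M (tate A 0)) x (a x) := rfl

theorem appC_prodSnd_extEnd (a : ∀ x, ℂ ⊗[ℚ] (M.fib x).V) (x : Points A)
    (v : ℂ ⊗[ℚ] ((prod M (tate A 0)).fib x).V) :
    appC (prodSnd M (tate A 0)) x (extEnd a x v) = 0 := by
  rw [extEnd_apply, map_smul, ← appC_comp, prodInl_snd, appC_zero, smul_zero]

theorem appC_prodFst_extEnd (a : ∀ x, ℂ ⊗[ℚ] (M.fib x).V) (x : Points A)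
    (v : ℂ ⊗[ℚ] ((prod M (tate A 0)).fib x).V) :
    appC (prodFst M (tate A 0)) x (extEnd a x v) =
      tateValC A 0 x (appC (prodSnd M (tate A 0)) x v) • a x := by
  rw [extEnd_apply, map_smul, ← appC_comp, prodInl_fst, appC_id]

/-- The endomorphism factors through `ℚ(0)`, which has weight `0`, and lands in `M`, whose weights
are `≤ -1`. So on `W_n` it vanishes for `n < 0`, and for `n ≥ 0` its values lie in `M = W_{n-1} M`.
-/
theorem extEnd_mem_W (hM : ∀ x, (M.fib x).W (-1) = ⊤) (a : ∀ x, ℂ ⊗[ℚ] (M.fib x).V)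
    (x : Points A) (n : ℤ) (v : ℂ ⊗[ℚ] ((prod M (tate A 0)).fib x).V)
    (hv : v ∈ (((prod M (tate A 0)).fib x).W n).baseChange ℂ) :
    extEnd a x v ∈ (((prod M (tate A 0)).fib x).W (n - 1)).baseChange ℂ := by
  rw [extEnd_apply]
  rcases lt_or_ge n 0 with hn | hn
  · have h := mem_baseChange_map ((app_isMor (prodSnd M (tate A 0)) x).map_W n) v hv
    rw [tate_W_of_lt (by omega), Submodule.baseChange_bot, Submodule.mem_bot] at h
    have h' : appC (prodSnd M (tate A 0)) x v = 0 := h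
    rw [h', map_zero, zero_smul]
    exact zero_mem _
  · refine Submodule.smul_mem _ _ (mem_baseChange_map
      ((app_isMor (prodInl M (tate A 0)) x).map_W (n - 1)) _ ?_)
    have hW : (M.fib x).W (n - 1) = ⊤ := top_le_iff.1 (hM x ▸ (M.fib x).W_mono (by omega))
    rw [hW, Submodule.baseChange_top]
    trivial

variable (hM : ∀ x, (M.fib x).W (-1) = ⊤) (a : M.invariants)

/-- The extension of `ℚ(0)` by `M` given by the family `a`: the sum `M ⊕ ℚ(0)`, with the Hodge
filtration translated by `a`. -/
noncomputable def ext (hM : ∀ x, (M.fib x).W (-1) = ⊤) (a : M.invariants) : Var A :=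
  twist (prod M (tate A 0)) (extEnd a.1)
    -- The square is zero: the image lies in `M`, which the projection to `ℚ(0)` kills.
    (fun x v => by rw [extEnd_apply, appC_prodSnd_extEnd, map_zero, zero_smul])
    (extEnd_mem_W hM a.1)
    -- The invariance of `a` is exactly what makes the translation compatible with `F_∞`.
    (fun h v => by
      rw [extEnd_apply, extEnd_apply, appC_conjDR, tateValC_conjDR, LinearMap.map_smulₛₗ,
        ← appC_conjDR, a.2 h])

end Extension

theorem tateVal_zero (x : Points A) (v : ((tate A 0).fib x).V) :
    tateVal A 0 x v = (tateCoord 0 x v : ℂ) := by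
  nth_rw 1 [← tateCoord_smul_tateGen 0 x v]
  rw [map_smul, tateVal_tateGen, zpow_zero, Rat.smul_def, mul_one]

/-- The linear map `(m, z) ↦ g m + z e` on the sum `M ⊕ ℚ(0)`. -/
noncomputable def extDescLin (g : M ⟶ E) (e : ∀ x, (E.fib x).V) (x : Points A) :
    ((prod M (tate A 0)).fib x).V →ₗ[ℚ] (E.fib x).V :=
  app g x ∘ₗ app (prodFst M (tate A 0)) x +
    LinearMap.toSpanSingleton ℚ _ (e x) ∘ₗ (tateCoord 0 x).toLinearMap ∘ₗ
      app (prodSnd M (tate A 0)) x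

theorem extDescLin_apply (g : M ⟶ E) (e : ∀ x, (E.fib x).V) (x : Points A)
    (v : ((prod M (tate A 0)).fib x).V) :
    extDescLin g e x v = app g x (app (prodFst M (tate A 0)) x v) +
      tateCoord 0 x (app (prodSnd M (tate A 0)) x v) • e x := rfl

theorem extDescLin_baseChange (g : M ⟶ E) (e : ∀ x, (E.fib x).V) (x : Points A)
    (v : ℂ ⊗[ℚ] ((prod M (tate A 0)).fib x).V) :
    (extDescLin g e x).baseChange ℂ v = appC g x (appC (prodFst M (tate A 0)) x v) +
      tateValC A 0 x (appC (prodSnd M (tate A 0)) x v) • ((1 : ℂ) ⊗ₜ[ℚ] e x) := by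
  induction v with
  | zero => simp only [map_zero, zero_smul, add_zero]
  | add a b ha hb => simp only [map_add, ha, hb, add_smul]; abel
  | tmul z v =>
    rw [LinearMap.baseChange_tmul, extDescLin_apply, appC_tmul, appC_tmul, appC_tmul,
      tateValC_tmul, tateVal_zero, TensorProduct.tmul_add, TensorProduct.smul_tmul',
      ← TensorProduct.smul_tmul, smul_eq_mul, mul_one, Rat.smul_def, mul_comm z]

/-- `F_∞` fixes the coordinate on `ℚ(0)`, because that coordinate is a rational number and
conjugation fixes it. -/
theorem extDescLin_Finf (g : M ⟶ E) {e : ∀ x, (E.fib x).V}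
    (he : ∀ {x y} (h : y = conjPoint x), E.Finf h (e x) = e y) {x y : Points A}
    (h : y = conjPoint x) (v : ((prod M (tate A 0)).fib x).V) :
    extDescLin g e y ((prod M (tate A 0)).Finf h v) = E.Finf h (extDescLin g e x v) := by
  have hc : ∀ v, tateCoord 0 y ((tate A 0).Finf h v) = tateCoord 0 x v := fun v => by
    have h1 := tateVal_Finf 0 h v
    rw [tateVal_zero, tateVal_zero, map_ratCast] at h1
    exact_mod_cast h1
  rw [extDescLin_apply, extDescLin_apply, app_Finf, app_Finf, app_Finf, hc, map_add, map_smul, he]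

section Extension

/-- The Hodge filtration of the extension given by `a`. -/
noncomputable def extF (a : ∀ x, ℂ ⊗[ℚ] (M.fib x).V) (x : Points A) (p : ℤ) :
    Submodule ℂ (ℂ ⊗[ℚ] ((prod M (tate A 0)).fib x).V) :=
  unipotentTwist (extEnd a x) (((prod M (tate A 0)).fib x).F p)

/-- In coordinates, `(m, z)` lies in `F^p` when `m - z a` and `z` do; the Hodge filtration is
generated by that of `M` together with `(a, 1)` in degrees `p ≤ 0`. -/
theorem mem_extF {a : ∀ x, ℂ ⊗[ℚ] (M.fib x).V} {x : Points A} {p : ℤ}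
    {v : ℂ ⊗[ℚ] ((prod M (tate A 0)).fib x).V} :
    v ∈ extF a x p ↔ appC (prodFst M (tate A 0)) x v -
        tateValC A 0 x (appC (prodSnd M (tate A 0)) x v) • a x ∈ (M.fib x).F p ∧
      appC (prodSnd M (tate A 0)) x v ∈ ((tate A 0).fib x).F p := by
  rw [extF, mem_unipotentTwist, mem_prod_F, map_sub, map_sub, appC_prodFst_extEnd,
    appC_prodSnd_extEnd, sub_zero]

/-- Write `(m, z) = (m - z a, 0) + z (a, 1)`. The first term is in `F^p M`; the second goes to `z`
times an element of `F⁰`, and `z = 0` as soon as `p > 0`. -/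
theorem extDescLin_mem_F {g : M ⟶ E} {e : ∀ x, (E.fib x).V} {a : ∀ x, ℂ ⊗[ℚ] (M.fib x).V}
    {x : Points A} (heF : appC g x (a x) + 1 ⊗ₜ e x ∈ (E.fib x).F 0) {p : ℤ}
    {v : ℂ ⊗[ℚ] ((prod M (tate A 0)).fib x).V} (hv : v ∈ extF a x p) :
    (extDescLin g e x).baseChange ℂ v ∈ (E.fib x).F p := by
  obtain ⟨h1, h2⟩ := mem_extF.1 hv
  have key : (extDescLin g e x).baseChange ℂ v =
      appC g x (appC (prodFst M (tate A 0)) x v -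
        tateValC A 0 x (appC (prodSnd M (tate A 0)) x v) • a x) +
      tateValC A 0 x (appC (prodSnd M (tate A 0)) x v) • (appC g x (a x) + 1 ⊗ₜ e x) := by
    rw [extDescLin_baseChange, map_sub, map_smul, smul_add]
    abel
  rw [key]
  refine add_mem (appC_mem_F g x h1) ?_
  rcases le_or_gt p 0 with hp | hp
  · exact Submodule.smul_mem _ _ ((E.fib x).F_anti hp heF)
  · rw [tate_F_of_lt (by omega), Submodule.mem_bot] at h2
    rw [h2, map_zero, zero_smul]
    exact zero_mem _

theorem extDescLin_mem_W (g : M ⟶ E) {e : ∀ x, (E.fib x).V} {x : Points A}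
    (heW : e x ∈ (E.fib x).W 0) {n : ℤ} {v : ((prod M (tate A 0)).fib x).V}
    (hv : v ∈ ((prod M (tate A 0)).fib x).W n) : extDescLin g e x v ∈ (E.fib x).W n := by
  obtain ⟨h1, h2⟩ := mem_prod_W.1 hv
  rw [extDescLin_apply]
  refine add_mem ((app_isMor g x).map_W n _ h1) ?_
  rcases lt_or_ge n 0 with hn | hn
  · rw [tate_W_of_lt (by omega), Submodule.mem_bot] at h2
    rw [h2, map_zero, zero_smul]
    exact zero_mem _
  · exact Submodule.smul_mem _ _ ((E.fib x).W_mono hn heW)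

variable (hM : ∀ x, (M.fib x).W (-1) = ⊤) (a : M.invariants)

/-- The inclusion of `M` in the extension. -/
noncomputable def extι : M ⟶ ext hM a :=
  mk' (fun x => app (prodInl M (tate A 0)) x)
    (fun x => ⟨(app_isMor (prodInl M (tate A 0)) x).map_W, fun p v hv => by
      -- The stalks of `ext` are by definition those of the direct sum. Phrasing the claim through
      -- `extF` on the direct sum makes the lemmas about its projections applicable.
      have h : appC (prodInl M (tate A 0)) x v ∈ extF a.1 x p := by
        rw [mem_extF, ← appC_comp, ← appC_comp, prodInl_fst, prodInl_snd, appC_zero, map_zero,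
          zero_smul, sub_zero, appC_id]
        exact ⟨hv, zero_mem _⟩
      exact h⟩)
    (fun h v => app_Finf (prodInl M (tate A 0)) h v)

/-- The projection of the extension to `ℚ(0)`. -/
noncomputable def extπ : ext hM a ⟶ tate A 0 :=
  mk' (fun x => app (prodSnd M (tate A 0)) x)
    (fun x => ⟨(app_isMor (prodSnd M (tate A 0)) x).map_W, fun p v hv => by
      have h : ∀ v ∈ extF a.1 x p, appC (prodSnd M (tate A 0)) x v ∈ ((tate A 0).fib x).F p :=
        fun v hv => (mem_extF.1 hv).2
      exact h v hv⟩)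
    (fun h v => app_Finf (prodSnd M (tate A 0)) h v)

theorem extι_π : extι hM a ≫ extπ hM a = 0 :=
  hom_ext fun x v => by
    have h : app (prodInl M (tate A 0) ≫ prodSnd M (tate A 0)) x v = 0 := by
      rw [prodInl_snd, app_zero]
    exact h

theorem ext_shortExact : (ShortComplex.mk _ _ (extι_π hM a)).ShortExact := by
  refine shortExact_of_app _ (fun x => ?_) (fun x v => ?_) (fun x => ?_)
  · have : Mono (prodInl M (tate A 0)) :=
      mono_of_mono_fac (h := 𝟙 M) prodInl_fst
    exact injective_of_mono (prodInl M (tate A 0)) x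
  · have h : app (prodInr M (tate A 0) ≫ prodSnd M (tate A 0)) x v = v := by
      rw [prodInr_snd, app_id]
    exact ⟨_, h⟩
  · have h : ∀ v : ((prod M (tate A 0)).fib x).V, app (prodSnd M (tate A 0)) x v = 0 →
        app (prodInl M (tate A 0)) x (app (prodFst M (tate A 0)) x v) = v := fun v hv => by
      have := app_prod_total x v
      rwa [hv, map_zero, add_zero] at this
    exact fun v hv => ⟨_, h v hv⟩

/-- A morphism from the extension is given by a morphism from `M` and a compatible family of images
of the generator of `ℚ(0)`. -/
noncomputable def extDesc (g : M ⟶ E) (e : ∀ x, (E.fib x).V)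
    (he : ∀ {x y} (h : y = conjPoint x), E.Finf h (e x) = e y) (heW : ∀ x, e x ∈ (E.fib x).W 0)
    (heF : ∀ x, appC g x (a.1 x) + 1 ⊗ₜ e x ∈ (E.fib x).F 0) : ext hM a ⟶ E :=
  mk' (extDescLin g e)
    (fun x => ⟨fun _ _ hv => extDescLin_mem_W g (heW x) hv,
      fun _ _ hv => extDescLin_mem_F (heF x) hv⟩)
    (fun h v => extDescLin_Finf g he h v)

variable {a} in
theorem extι_extDesc (g : M ⟶ E) (e : ∀ x, (E.fib x).V) (he) (heW) (heF) :
    extι hM a ≫ extDesc hM a g e he heW heF = g :=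
  hom_ext fun x v => by
    have h : extDescLin g e x (app (prodInl M (tate A 0)) x v) = app g x v := by
      rw [extDescLin_apply, ← app_comp (prodInl M (tate A 0)) (prodFst M (tate A 0)),
        ← app_comp (prodInl M (tate A 0)) (prodSnd M (tate A 0)), prodInl_fst, prodInl_snd,
        app_zero, map_zero, zero_smul, add_zero, app_id]
    exact h

variable {a} in
theorem extDesc_comp (g : M ⟶ E) (e : ∀ x, (E.fib x).V) (he) (heW) (heF) {p : E ⟶ tate A 0}
    (hg : g ≫ p = 0) (hp : ∀ x, app p x (e x) = tateGen 0 x) :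
    extDesc hM a g e he heW heF ≫ p = extπ hM a :=
  hom_ext fun x v => by
    have h : ∀ v, app p x (extDescLin g e x v) = app (prodSnd M (tate A 0)) x v := fun v => by
      rw [extDescLin_apply, map_add, ← app_comp, hg, app_zero, zero_add, map_smul, hp,
        tateCoord_smul_tateGen]
    exact h v

/-- The lift of the generator of `ℚ(0)` to the extension. -/
noncomputable def extGen (x : Points A) : ((ext hM a).fib x).V :=
  app (prodInr M (tate A 0)) x (tateGen 0 x)

theorem Finf_tateGen_zero {x y : Points A} (h : y = conjPoint x) :
    (tate A 0).Finf h (tateGen 0 x) = tateGen 0 y :=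
  tateVal_injective 0 y (by
    rw [tateVal_Finf, tateVal_tateGen, tateVal_tateGen, zpow_zero, map_one])

theorem Finf_extGen {x y : Points A} (h : y = conjPoint x) :
    (ext hM a).Finf h (extGen hM a x) = extGen hM a y := by
  have h : (prod M (tate A 0)).Finf h (app (prodInr M (tate A 0)) x (tateGen 0 x)) =
      app (prodInr M (tate A 0)) y (tateGen 0 y) := by
    rw [← app_Finf, Finf_tateGen_zero]
  exact h

theorem extGen_mem_W (x : Points A) : extGen hM a x ∈ ((ext hM a).fib x).W 0 := by
  have h : tateGen 0 x ∈ ((tate A 0).fib x).W 0 := by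
    rw [tate_W_of_le (by omega)]
    trivial
  exact (app_isMor (prodInr M (tate A 0)) x).map_W 0 _ h

theorem app_extπ_extGen (x : Points A) : app (extπ hM a) x (extGen hM a x) = tateGen 0 x := by
  have h : app (prodInr M (tate A 0) ≫ prodSnd M (tate A 0)) x (tateGen 0 x) = tateGen 0 x := by
    rw [prodInr_snd, app_id]
  exact h

/-- The pair `(a, 1)` is a Hodge lift of `1` and `(0, 1)` a rational one, so the extension given by
`a` has `e_F - e_ℚ = a`. -/
theorem appC_extι_add_extGen_mem_F (x : Points A) :
    appC (extι hM a) x (a.1 x) + 1 ⊗ₜ extGen hM a x ∈ ((ext hM a).fib x).F 0 := by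
  have h : appC (prodInl M (tate A 0)) x (a.1 x) +
      1 ⊗ₜ app (prodInr M (tate A 0)) x (tateGen 0 x) ∈ extF a.1 x 0 := by
    rw [mem_extF, ← appC_tmul, map_add, map_add, ← appC_comp, ← appC_comp, ← appC_comp,
      ← appC_comp, prodInl_fst, prodInl_snd, prodInr_fst, prodInr_snd, appC_zero, appC_zero,
      appC_id, appC_id, zero_add, add_zero, tateValC_tmul, tateVal_tateGen, zpow_zero, one_mul,
      one_smul, sub_self]
    refine ⟨zero_mem _, ?_⟩
    rw [tate_F_of_le (by omega)]
    trivial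
  exact h

end Extension

/-! ### The homomorphism from invariant families to `Ext¹(ℚ(0), M)` and its kernel. -/

open Abelian

theorem prod_W_eq_top (hM : ∀ x, (M.fib x).W (-1) = ⊤) (hN : ∀ x, (N.fib x).W (-1) = ⊤)
    (x : Points A) : ((prod M N).fib x).W (-1) = ⊤ := by
  refine top_le_iff.1 fun v _ => mem_prod_W.2 ?_
  rw [hM, hN]
  exact ⟨trivial, trivial⟩

/-- The class in `Ext¹(ℚ(0), M)` of the extension given by the family `a`. -/
noncomputable def invariantsClass (hM : ∀ x, (M.fib x).W (-1) = ⊤) (a : M.invariants) :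
    Ext.{max 1 u} (tate A 0) M 1 :=
  (ext_shortExact hM a).extClass

/-- The elements `e` define a morphism from the extension of `a` to the given one that is `f` on the
subobject and the identity on `ℚ(0)`; naturality of extension classes does the rest. With the
standard extension as target this is functoriality in `M`, and with `f = 𝟙` it computes the class of
an arbitrary extension. -/
theorem invariantsClass_comp (hM : ∀ x, (M.fib x).W (-1) = ⊤) (a : M.invariants) (f : M ⟶ N)
    {i : N ⟶ E} {p : E ⟶ tate A 0} {w : i ≫ p = 0} (hS : (ShortComplex.mk i p w).ShortExact)
    (e : ∀ x, (E.fib x).V) (he : ∀ {x y} (h : y = conjPoint x), E.Finf h (e x) = e y)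
    (heW : ∀ x, e x ∈ (E.fib x).W 0) (hp : ∀ x, app p x (e x) = tateGen 0 x)
    (heF : ∀ x, appC (f ≫ i) x (a.1 x) + 1 ⊗ₜ e x ∈ (E.fib x).F 0) :
    (invariantsClass hM a).comp (Ext.mk₀ f) (add_zero 1) = hS.extClass := by
  let φ : ShortComplex.mk _ _ (extι_π hM a) ⟶ ShortComplex.mk i p w :=
    { τ₁ := f
      τ₂ := extDesc hM a (f ≫ i) e he heW heF
      τ₃ := 𝟙 _
      comm₁₂ := (extι_extDesc hM (f ≫ i) e he heW heF).symm
      comm₂₃ := (extDesc_comp hM (f ≫ i) e he heW heF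
        (by rw [Category.assoc, w, comp_zero]) hp).trans (Category.comp_id _).symm }
  exact (ShortComplex.ShortExact.extClass_naturality (ext_shortExact hM a) hS φ).trans
    (Ext.mk₀_id_comp _)

theorem invariantsClass_comp_mk₀ (hM : ∀ x, (M.fib x).W (-1) = ⊤)
    (hN : ∀ x, (N.fib x).W (-1) = ⊤) (a : M.invariants) (f : M ⟶ N) :
    (invariantsClass hM a).comp (Ext.mk₀ f) (add_zero 1) =
      invariantsClass hN (invariantsMap f a) :=
  invariantsClass_comp hM a f (ext_shortExact hN _) (extGen hN _) (Finf_extGen hN _)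
    (extGen_mem_W hN _) (app_extπ_extGen hN _) fun x => by
      rw [appC_comp]
      exact appC_extι_add_extGen_mem_F hN (invariantsMap f a) x

theorem extClass_eq_invariantsClass (hM : ∀ x, (M.fib x).W (-1) = ⊤)
    {i : M ⟶ E} {p : E ⟶ tate A 0} {w : i ≫ p = 0} (hS : (ShortComplex.mk i p w).ShortExact)
    (e : ∀ x, (E.fib x).V) (he : ∀ {x y} (h : y = conjPoint x), E.Finf h (e x) = e y)
    (heW : ∀ x, e x ∈ (E.fib x).W 0) (hp : ∀ x, app p x (e x) = tateGen 0 x) (a : M.invariants)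
    (heF : ∀ x, appC i x (a.1 x) + 1 ⊗ₜ e x ∈ (E.fib x).F 0) :
    hS.extClass = invariantsClass hM a := by
  rw [← invariantsClass_comp hM a (𝟙 M) hS e he heW hp (by simpa using heF)]
  exact Ext.comp_mk₀_id _

/-- The pair `c = (a, b)` is an invariant family of `M ⊕ M`. The two projections and their sum push
it to `a`, `b` and `a + b`, and composition in `Ext` is additive in the morphism. -/
theorem invariantsClass_add (hM : ∀ x, (M.fib x).W (-1) = ⊤) (a b : M.invariants) :
    invariantsClass hM (a + b) = invariantsClass hM a + invariantsClass hM b := by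
  let c : (prod M M).invariants := invariantsMap (prodInl M M) a + invariantsMap (prodInr M M) b
  have ha : invariantsMap (prodFst M M) c = a := by
    rw [map_add, ← invariantsMap_comp, ← invariantsMap_comp, prodInl_fst, prodInr_fst,
      invariantsMap_id, invariantsMap_hom_zero, add_zero]
  have hb : invariantsMap (prodSnd M M) c = b := by
    rw [map_add, ← invariantsMap_comp, ← invariantsMap_comp, prodInl_snd, prodInr_snd,
      invariantsMap_id, invariantsMap_hom_zero, zero_add]
  have hab : invariantsMap (prodFst M M + prodSnd M M) c = a + b := by
    rw [invariantsMap_hom_add, ha, hb]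
  have hMM := prod_W_eq_top hM hM
  rw [← hab, ← invariantsClass_comp_mk₀ hMM hM, Ext.mk₀_add, Ext.comp_add,
    invariantsClass_comp_mk₀ hMM hM, invariantsClass_comp_mk₀ hMM hM, ha, hb]

/-- The class of the extension, as a homomorphism. -/
noncomputable def invariantsClassHom (hM : ∀ x, (M.fib x).W (-1) = ⊤) :
    M.invariants →+ Ext.{max 1 u} (tate A 0) M 1 :=
  AddMonoidHom.mk' (invariantsClass hM) (invariantsClass_add hM)

theorem one_tmul_injective {V : Type*} [AddCommGroup V] [Module ℚ V] :
    Function.Injective fun v : V => (1 : ℂ) ⊗ₜ[ℚ] v :=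
  Module.FaithfullyFlat.tensorProduct_mk_injective V

theorem invariantsClass_eq_zero_iff (hM : ∀ x, (M.fib x).W (-1) = ⊤)
    (hF : ∀ x, (M.fib x).F 0 = ⊥) (a : M.invariants) :
    invariantsClass hM a = 0 ↔ ∀ x, ∃ m, a.1 x = 1 ⊗ₜ m := by
  constructor
  · intro h x
    obtain ⟨s, hs⟩ := (ext_shortExact hM a).exists_section_of_extClass_eq_zero h
    -- A splitting sends the generator to a rational `(m, 1)` in `F⁰`. This forces `m - a ∈ F⁰M =
    -- 0`, so `a` is rational.
    have key : ∀ v : ((prod M (tate A 0)).fib x).V,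
        app (prodSnd M (tate A 0)) x v = tateGen 0 x →
        (1 : ℂ) ⊗ₜ v ∈ extF a.1 x 0 → ∃ m, a.1 x = 1 ⊗ₜ m := fun v hv hvF => by
      obtain ⟨h1, -⟩ := mem_extF.1 hvF
      rw [appC_tmul, appC_tmul, hv, tateValC_tmul, tateVal_tateGen, zpow_zero, one_mul, one_smul,
        hF, Submodule.mem_bot, sub_eq_zero] at h1
      exact ⟨_, h1.symm⟩
    have h1 : app (extπ hM a) x (app s x (tateGen 0 x)) = tateGen 0 x := by
      rw [← app_comp]
      exact congrArg (fun f => app f x (tateGen 0 x)) hs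
    refine key (app s x (tateGen 0 x)) h1 (appC_mem_F (N := ext hM a) s x (p := 0)
      (v := 1 ⊗ₜ tateGen 0 x) ?_)
    have h2 : ((tate A 0).fib x).F 0 = ⊤ := tate_F_of_le (by omega) x
    exact h2 ▸ trivial
  · intro h
    choose m hm using h
    -- The rational family `m` inherits invariance from `a`, since `v ↦ 1 ⊗ v` is injective.
    have hmF : ∀ {x y} (h : y = conjPoint x), M.Finf h (m x) = m y := fun {x y} h =>
      one_tmul_injective (by
        have := a.2 h
        rw [hm, hm, conjDR_tmul, map_one] at this
        exact this)
    -- The retraction is `(n, z) ↦ n - z m`; it respects `F` because it sends `(a, 1)` to `a - m =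
    -- 0`.
    refine (ext_shortExact hM a).extClass_eq_zero_of_retraction
      (extDesc hM a (𝟙 M) (fun x => -m x) (fun h => by rw [map_neg, hmF h]) (fun x => ?_)
        fun x => ?_) (extι_extDesc hM _ _ _ _ _)
    · have : (M.fib x).W 0 = ⊤ := top_le_iff.1 (hM x ▸ (M.fib x).W_mono (by omega))
      rw [this]
      trivial
    · rw [appC_id, hm, TensorProduct.tmul_neg, add_neg_cancel]
      exact zero_mem _

/-! ### Rational and Hodge lifts in an arbitrary extension. -/

section Lifts

variable {i : M ⟶ E} {p : E ⟶ tate A 0} {w : i ≫ p = 0}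

/-- Both `M` and `ℚ(0)` have weights `≤ 0`; by strictness so has the extension, and any rational
lift is admissible for `W`. -/
theorem mem_W_zero_of_shortExact (hM : ∀ x, (M.fib x).W (-1) = ⊤)
    (hS : (ShortComplex.mk i p w).ShortExact) {x : Points A} (v : (E.fib x).V) :
    v ∈ (E.fib x).W 0 := by
  have h : app p x v ∈ ((tate A 0).fib x).W 0 := by
    rw [tate_W_of_le (by omega)]
    trivial
  obtain ⟨v', hv', e⟩ := ((app_isMor p x).le_map_of_surjective (surjective_of_shortExact hS x)).1 0 h
  obtain ⟨m, hm⟩ := exists_app_eq_of_shortExact hS (x := x) (v := v - v')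
    (by rw [map_sub, e, sub_self])
  have hmW : m ∈ (M.fib x).W (-1) := hM x ▸ trivial
  rw [← sub_add_cancel v v', ← hm]
  exact add_mem ((E.fib x).W_mono (by omega) ((app_isMor i x).map_W _ _ hmW)) hv'

/-- `F_∞` preserves the set of lifts of the generator, so averaging a lift with its transform gives
an invariant one. -/
theorem exists_rational_lift (hS : (ShortComplex.mk i p w).ShortExact) :
    ∃ e : ∀ x, (E.fib x).V, (∀ {x y} (h : y = conjPoint x), E.Finf h (e x) = e y) ∧
      ∀ x, app p x (e x) = tateGen 0 x := by
  choose b hb using fun x => surjective_of_shortExact hS x (tateGen 0 x)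
  have hc : ∀ x : Points A, x = conjPoint (conjPoint x) := fun x =>
    AlgHom.ext fun r => (Complex.conj_conj _).symm
  have hFb : ∀ {x y} (h : y = conjPoint x), app p y (E.Finf h (b x)) = tateGen 0 y := fun h => by
    rw [app_Finf, hb, Finf_tateGen_zero]
  refine ⟨fun x => (1 / 2 : ℚ) • (b x + E.Finf (hc x) (b (conjPoint x))), fun {x y} h => ?_,
    fun x => ?_⟩
  · subst h
    rw [map_smul, map_add, E.Finf_Finf (hc x) rfl, add_comm]
    congr 2
    -- `conjPoint (conjPoint x)` equals `x` only propositionally, so the two values of `b` are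
    -- compared by transport along a free variable `z`.
    have : ∀ {z} (hz : z = x) (h' : conjPoint x = conjPoint z),
        E.Finf rfl (b x) = E.Finf h' (b z) := by
      rintro z rfl h'
      rfl
    exact this (hc x).symm _
  · rw [map_smul, map_add, hb, hFb, ← two_smul ℚ, smul_smul]
    norm_num

/-- This is strictness: the surjection `p` maps `F⁰` of the extension onto `F⁰` of `ℚ(0)`. -/
theorem exists_hodge_lift (hS : (ShortComplex.mk i p w).ShortExact) (x : Points A) :
    ∃ e ∈ (E.fib x).F 0, appC p x e = 1 ⊗ₜ tateGen 0 x := by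
  have h : (1 : ℂ) ⊗ₜ tateGen 0 x ∈ ((tate A 0).fib x).F 0 := by
    rw [tate_F_of_le (by omega)]
    trivial
  obtain ⟨e, he, h'⟩ :=
    ((app_isMor p x).le_map_of_surjective (surjective_of_shortExact hS x)).2 0 h
  exact ⟨e, he, h'⟩

/-- Two lifts differ by an element of `M_ℂ` which lies in `F⁰M` by strictness of `i`, and `F⁰M = 0`.
-/
theorem hodge_lift_unique (hF : ∀ x, (M.fib x).F 0 = ⊥)
    (hS : (ShortComplex.mk i p w).ShortExact) {x : Points A} {e e' : ℂ ⊗[ℚ] (E.fib x).V}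
    (he : e ∈ (E.fib x).F 0) (he' : e' ∈ (E.fib x).F 0) (h : appC p x e = appC p x e') :
    e = e' := by
  have hk : e - e' ∈ LinearMap.range (appC i x) := by
    rw [range_appC_of_shortExact hS, LinearMap.mem_ker, map_sub, h, sub_self]
  obtain ⟨t, ht⟩ := hk
  have htF : t ∈ (M.fib x).F 0 :=
    ((app_isMor i x).le_comap_of_injective (injective_of_shortExact hS x)).2 0 (by
      rw [Submodule.mem_comap]
      exact ht.symm ▸ sub_mem he he')
  rw [hF, Submodule.mem_bot] at htF
  rw [← sub_eq_zero, ← ht, htF, map_zero]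

/-- Every extension of `ℚ(0)` by `M` has compatible families of lifts of the generator to the
rational spaces and to the Hodge filtrations, and its class is given by their difference. -/
theorem exists_lifts (hM : ∀ x, (M.fib x).W (-1) = ⊤) (hF : ∀ x, (M.fib x).F 0 = ⊥)
    (hS : (ShortComplex.mk i p w).ShortExact) :
    ∃ (e : ∀ x, (E.fib x).V) (a : M.invariants), (∀ x, app p x (e x) = tateGen 0 x) ∧
      (∀ x, appC i x (a.1 x) + 1 ⊗ₜ e x ∈ (E.fib x).F 0) ∧
      hS.extClass = invariantsClass hM a := by
  obtain ⟨e, he, hpe⟩ := exists_rational_lift hS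
  choose f hf hpf using exists_hodge_lift hS
  have hr : ∀ x, f x - 1 ⊗ₜ e x ∈ LinearMap.range (appC i x) := fun x => by
    rw [range_appC_of_shortExact hS, LinearMap.mem_ker, map_sub, hpf, appC_tmul, hpe, sub_self]
  choose t ht using hr
  -- The involution preserves `F⁰` and the generator, so it carries a Hodge lift to a Hodge lift; by
  -- uniqueness no averaging is needed here.
  have hff : ∀ {x y} (h : y = conjPoint x), E.conjDR h (f x) = f y := fun {x y} h =>
    hodge_lift_unique hF hS (conjDR_mem_F h (hf x)) (hf y) (by
      rw [appC_conjDR, hpf, hpf, conjDR_tmul, map_one, Finf_tateGen_zero])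
  have htt : ∀ {x y} (h : y = conjPoint x), M.conjDR h (t x) = t y := fun {x y} h =>
    appC_injective (injective_of_shortExact hS y) (by
      rw [appC_conjDR, ht, ht, map_sub, hff, conjDR_tmul, map_one, he])
  have hFt : ∀ x, appC i x (t x) + 1 ⊗ₜ e x ∈ (E.fib x).F 0 := fun x => by
    rw [ht, sub_add_cancel]
    exact hf x
  exact ⟨e, ⟨t, htt⟩, hpe, hFt, extClass_eq_invariantsClass hM hS e he
    (fun x => mem_W_zero_of_shortExact hM hS (e x)) hpe ⟨t, htt⟩ hFt⟩

end Lifts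

theorem invariantsClass_surjective (hM : ∀ x, (M.fib x).W (-1) = ⊤)
    (hF : ∀ x, (M.fib x).F 0 = ⊥) : Function.Surjective (invariantsClass hM) := fun c => by
  obtain ⟨E, i, p, w, hS, rfl⟩ := Ext.exists_extClass_eq c
  obtain ⟨-, a, -, -, h⟩ := exists_lifts hM hF hS
  exact ⟨a, h.symm⟩

end Var

/-! ### Complex points and embeddings of a number field, and the quotient `(⨁ ℂ/(2πi)^j ℚ)⁺`. -/

variable {F : Type u} [Field F] [NumberField F]

/-- The complex point of `Spec (ℝ ⊗ F)` that corresponds to an embedding `F → ℂ`. -/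
noncomputable def pointOf (σ : F →+* ℂ) : Points (ℝ ⊗[ℚ] F) :=
  Algebra.TensorProduct.lift (Algebra.ofId ℝ ℂ) σ.toRatAlgHom fun _ _ => Commute.all _ _

theorem embeddingOf_apply (x : Points (ℝ ⊗[ℚ] F)) (r : F) : embeddingOf x r = x (1 ⊗ₜ r) := rfl

@[simp]
theorem embeddingOf_pointOf (σ : F →+* ℂ) : embeddingOf (pointOf σ) = σ :=
  RingHom.ext fun r => by
    rw [embeddingOf_apply, pointOf, Algebra.TensorProduct.lift_tmul, map_one, one_mul]
    rfl

theorem embeddingOf_injective :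
    Function.Injective (embeddingOf : Points (ℝ ⊗[ℚ] F) → (F →+* ℂ)) := fun _ _ h =>
  Algebra.TensorProduct.ext (Subsingleton.elim _ _) (AlgHom.ext fun r => RingHom.congr_fun h r)

theorem embeddingOf_conjPoint (x : Points (ℝ ⊗[ℚ] F)) :
    embeddingOf (conjPoint x) = NumberField.ComplexEmbedding.conjugate (embeddingOf x) := rfl

theorem pointOf_conjugate (σ : F →+* ℂ) :
    pointOf (NumberField.ComplexEmbedding.conjugate σ) = conjPoint (pointOf σ) :=
  embeddingOf_injective (by rw [embeddingOf_conjPoint, embeddingOf_pointOf, embeddingOf_pointOf])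

theorem pointOf_eq_conjPoint (σ : F →+* ℂ) :
    pointOf σ = conjPoint (pointOf (NumberField.ComplexEmbedding.conjugate σ)) := by
  rw [← pointOf_conjugate, NumberField.ComplexEmbedding.involutive_conjugate]

theorem conjQuot_mk (j : ℤ) (z : ℂ) :
    conjQuot j (Submodule.Quotient.mk z) = Submodule.Quotient.mk (starRingEnd ℂ z) := rfl

/-- The map from the invariant families of complexified elements of `ℚ(j)` to
`(⨁_σ ℂ / (2πi)^j ℚ)^+`. -/
noncomputable def toPlusPart (j : ℤ) : (tate (ℝ ⊗[ℚ] F) j).invariants →+ plusPart F j where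
  toFun a := ⟨fun σ => Submodule.Quotient.mk (tateValC _ j (pointOf σ) (a.1 (pointOf σ))),
    fun σ => by
      rw [conjQuot_mk, ← tateValC_conjDR j (pointOf_eq_conjPoint σ), a.2]⟩
  map_zero' := Subtype.ext (funext fun σ =>
    congrArg Submodule.Quotient.mk (map_zero (tateValC _ j (pointOf σ))))
  map_add' a b := Subtype.ext (funext fun σ => congrArg Submodule.Quotient.mk
    (map_add (tateValC _ j (pointOf σ)) (a.1 (pointOf σ)) (b.1 (pointOf σ))))

theorem toPlusPart_embeddingOf {j : ℤ} (a : (tate (ℝ ⊗[ℚ] F) j).invariants)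
    (x : Points (ℝ ⊗[ℚ] F)) : (toPlusPart j a : (F →+* ℂ) → ℂ ⧸ tateLine j) (embeddingOf x) =
      Submodule.Quotient.mk (tateValC _ j x (a.1 x)) := by
  have h : pointOf (embeddingOf x) = x := embeddingOf_injective (embeddingOf_pointOf _)
  change Submodule.Quotient.mk (tateValC _ j (pointOf (embeddingOf x)) (a.1 _)) = _
  rw [h]

/-- The right-hand side is the condition for the extension given by `a` to split, so this map and
the class map have the same kernel. -/
theorem toPlusPart_eq_zero_iff {j : ℤ} (a : (tate (ℝ ⊗[ℚ] F) j).invariants) :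
    toPlusPart j a = 0 ↔ ∀ x, ∃ m, a.1 x = 1 ⊗ₜ m := by
  simp only [← tateValC_mem_iff]
  constructor
  · intro h x
    rw [← Submodule.Quotient.mk_eq_zero, ← toPlusPart_embeddingOf, h]
    rfl
  · exact fun h => Subtype.ext (funext fun σ => (Submodule.Quotient.mk_eq_zero _).2 (h _))

/-- Taking invariants of an involution is exact over `ℚ`: averaging any lift with its conjugate
gives an equivariant lift. -/
theorem exists_conj_eq_lift {F : Type u} [Field F] {j : ℤ} (s : plusPart F j) :
    ∃ c : (F →+* ℂ) → ℂ,
    (∀ σ, starRingEnd ℂ (c (NumberField.ComplexEmbedding.conjugate σ)) = c σ) ∧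
      ∀ σ, Submodule.Quotient.mk (c σ) = s.1 σ := by
  choose b hb using fun σ => Submodule.Quotient.mk_surjective (tateLine j) (s.1 σ)
  refine ⟨fun σ => (1 / 2 : ℚ) •
    (b σ + starRingEnd ℂ (b (NumberField.ComplexEmbedding.conjugate σ))), fun σ => ?_, fun σ => ?_⟩
  · simp only [Rat.smul_def, map_mul, map_ratCast, map_add, Complex.conj_conj,
      NumberField.ComplexEmbedding.involutive_conjugate F σ]
    rw [add_comm]
  -- Both terms of the average reduce to `s σ` modulo `(2πi)^j ℚ`, because `s` is fixed by the
  -- involution.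
  · have h := s.2 σ
    rw [← hb, conjQuot_mk] at h
    rw [Submodule.Quotient.mk_smul, Submodule.Quotient.mk_add, h, hb, ← two_smul ℚ, smul_smul]
    norm_num

theorem toPlusPart_surjective (j : ℤ) :
    Function.Surjective (toPlusPart (F := F) j) := fun s => by
  obtain ⟨c, hc, hs⟩ := exists_conj_eq_lift s
  choose a ha using fun x : Points (ℝ ⊗[ℚ] F) => tateValC_surjective j x (c (embeddingOf x))
  refine ⟨⟨a, fun {x y} h => tateValC_injective j y ?_⟩, Subtype.ext (funext fun σ => ?_)⟩
  · rw [tateValC_conjDR, ha, ha, ← hc (embeddingOf y), h, embeddingOf_conjPoint,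
      NumberField.ComplexEmbedding.involutive_conjugate]
  · rw [← hs, ← embeddingOf_pointOf σ, toPlusPart_embeddingOf, ha]

theorem tate_W_neg_one {A : Type u} [CommRing A] [Algebra ℝ A] {j : ℤ} (hj : 1 ≤ j)
    (x : Points A) : ((tate A j).fib x).W (-1) = ⊤ :=
  tate_W_of_le (by omega) x

theorem tate_F_zero {A : Type u} [CommRing A] [Algebra ℝ A] {j : ℤ} (hj : 1 ≤ j)
    (x : Points A) : ((tate A j).fib x).F 0 = ⊥ :=
  tate_F_of_lt (by omega) x

open Abelian

/-- The isomorphism of `Ext¹(ℚ(0), ℚ(j))` with `(⨁_σ ℂ / (2πi)^j ℚ)^+`. -/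
noncomputable def extTateEquiv (F : Type u) [Field F] [NumberField F] {j : ℤ} (hj : 1 ≤ j) :
    Ext.{max 1 u} (tate (ℝ ⊗[ℚ] F) 0) (tate (ℝ ⊗[ℚ] F) j) 1 ≃ₗ[ℚ] plusPart F j :=
  AddEquiv.toLinearEquiv
    -- Both groups are quotients of the invariant families by the same kernel. The resulting
    -- additive bijection of `ℚ`-vector spaces is automatically `ℚ`-linear.
    ((QuotientAddGroup.quotientKerEquivOfSurjective
      (Var.invariantsClassHom (M := tate (ℝ ⊗[ℚ] F) j) (tate_W_neg_one hj))
      (Var.invariantsClass_surjective (tate_W_neg_one hj) (tate_F_zero hj))).symm.trans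
    ((QuotientAddGroup.quotientAddEquivOfEq (AddSubgroup.ext fun a =>
      (Var.invariantsClass_eq_zero_iff (tate_W_neg_one hj) (tate_F_zero hj) a).trans
        (toPlusPart_eq_zero_iff a).symm)).trans
    (QuotientAddGroup.quotientKerEquivOfSurjective (toPlusPart j) (toPlusPart_surjective j))))
    (map_rat_smul _)

theorem extTateEquiv_invariantsClass {j : ℤ} (hj : 1 ≤ j)
    (a : (tate (ℝ ⊗[ℚ] F) j).invariants) :
    extTateEquiv F hj (Var.invariantsClass (tate_W_neg_one hj) a) = toPlusPart j a := by
  let e := QuotientAddGroup.quotientKerEquivOfSurjective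
    (Var.invariantsClassHom (M := tate (ℝ ⊗[ℚ] F) j) (tate_W_neg_one hj))
    (Var.invariantsClass_surjective (tate_W_neg_one hj) (tate_F_zero hj))
  have h : e.symm (Var.invariantsClass (tate_W_neg_one hj) a) = QuotientAddGroup.mk a :=
    (AddEquiv.symm_apply_eq e).2 rfl
  exact congrArg (fun c => QuotientAddGroup.quotientKerEquivOfSurjective (toPlusPart j)
    (toPlusPart_surjective j) (QuotientAddGroup.quotientAddEquivOfEq (AddSubgroup.ext fun a =>
      (Var.invariantsClass_eq_zero_iff (tate_W_neg_one hj) (tate_F_zero hj) a).trans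
        (toPlusPart_eq_zero_iff a).symm) c)) h

end Hodge

theorem mainTheorem6 (F : Type u) [Field F] [NumberField F] (j : ℤ) (hj : 1 ≤ j) :
    ∃! Φ : Abelian.Ext.{max 1 u} (Hodge.tate (ℝ ⊗[ℚ] F) 0) (Hodge.tate (ℝ ⊗[ℚ] F) j) 1 ≃ₗ[ℚ]
        Hodge.plusPart F j,
      ∀ (E : Hodge.Var (ℝ ⊗[ℚ] F))
        (i : Hodge.tate (ℝ ⊗[ℚ] F) j ⟶ E) (p : E ⟶ Hodge.tate (ℝ ⊗[ℚ] F) 0) (w : i ≫ p = 0)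
        (hS : (ShortComplex.mk i p w).ShortExact) (x : Hodge.Points (ℝ ⊗[ℚ] F))
        (eQ : (E.fib x).V) (_ : Hodge.tateVal (ℝ ⊗[ℚ] F) 0 x (Hodge.Var.app p x eQ) = 1)
        (eF : ℂ ⊗[ℚ] (E.fib x).V) (_ : eF ∈ (E.fib x).F 0)
        (_ : Hodge.tateValC (ℝ ⊗[ℚ] F) 0 x (Hodge.Var.appC p x eF) = 1)
        (t : ℂ ⊗[ℚ] ((Hodge.tate (ℝ ⊗[ℚ] F) j).fib x).V)
        (_ : Hodge.Var.appC i x t = eF - 1 ⊗ₜ[ℚ] eQ),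
        (Φ hS.extClass : (F →+* ℂ) → ℂ ⧸ Hodge.tateLine j) (Hodge.embeddingOf x) =
          Submodule.Quotient.mk (Hodge.tateValC (ℝ ⊗[ℚ] F) j x t) := by
  open Hodge Hodge.Var in
  have hval : ∀ x : Points (ℝ ⊗[ℚ] F), tateVal _ 0 x (tateGen 0 x) = 1 := fun x => by
    rw [tateVal_tateGen, zpow_zero]
  have hvalC : ∀ x : Points (ℝ ⊗[ℚ] F), tateValC _ 0 x (1 ⊗ₜ tateGen 0 x) = 1 := fun x => by
    rw [tateValC_tmul, hval, one_mul]
  refine ⟨extTateEquiv F hj, ?_, fun Φ hΦ => LinearEquiv.ext fun c => ?_⟩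
  · intro E i p w hS x eQ heQ eF heF hpeF t ht
    obtain ⟨e, a, he, hFe, hcl⟩ := exists_lifts (tate_W_neg_one hj) (tate_F_zero hj) hS
    rw [hcl, extTateEquiv_invariantsClass, toPlusPart_embeddingOf]
    -- The given Hodge lift is the chosen one, by uniqueness.
    have h1 : eF = appC i x (a.1 x) + 1 ⊗ₜ e x :=
      hodge_lift_unique (tate_F_zero hj) hS heF (hFe x) (tateValC_injective 0 x (by
        rw [hpeF, map_add, ← appC_comp, w, appC_zero, zero_add, appC_tmul, he, hvalC]))
    -- The given rational lift differs from the chosen one by a rational `m` of `ℚ(j)`, which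
    -- disappears in the quotient by `(2πi)^j ℚ`.
    obtain ⟨m, hm⟩ := exists_app_eq_of_shortExact hS (x := x) (v := e x - eQ)
      (tateVal_injective 0 x (by rw [map_sub, map_sub, he, heQ, hval, sub_self, map_zero]))
    have h2 : t = a.1 x + 1 ⊗ₜ m := appC_injective (injective_of_shortExact hS x) (by
      rw [ht, h1, map_add, appC_tmul, hm, TensorProduct.tmul_sub, add_sub_assoc])
    rw [h2, eq_comm, Submodule.Quotient.eq, map_add, add_sub_cancel_left]
    exact tateValC_mem_iff.2 ⟨m, rfl⟩
  -- Uniqueness: every class comes from an extension, and applying the property of `Φ` to its chosen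
  -- lifts, with `e_F - e_ℚ` the image of `a`, forces each component to be that of `toPlusPart j a`.
  · obtain ⟨E, i, p, w, hS, rfl⟩ := Abelian.Ext.exists_extClass_eq c
    obtain ⟨e, a, he, hFe, hcl⟩ := exists_lifts (tate_W_neg_one hj) (tate_F_zero hj) hS
    refine Subtype.ext (funext fun σ => ?_)
    rw [← embeddingOf_pointOf σ]
    rw [hΦ E i p w hS (pointOf σ) (e _) (by rw [he, hval]) _ (hFe _) (by
      rw [map_add, ← appC_comp, w, appC_zero, zero_add, appC_tmul, he, hvalC]) (a.1 _)
      (add_sub_cancel_right _ _).symm, hcl, extTateEquiv_invariantsClass, toPlusPart_embeddingOf]
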